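/- Let $d\ge 2$, $\mu>-1/2$, and let $B=\{x\in\mathbb{R}^d:|x|\le 1\}$ be the closed Euclidean unit ball, with the measure $dW_\mu(x)=(1-|x|^2)^{\mu-1/2}\,dx$ and the geodesic distance $$d_B(x,y)=\arccos\big(\langle x,y\rangle+\sqrt{1-|x|^2}\sqrt{1-|y|^2}\big),\qquad x,y\in B .$$ For $z\in B$ and $r>0$ put $B(z,r)=\{y\in B: d_B(z,y)<r\}$ and $f_{B(z,r)}=W_\mu(B(z,r))^{-1}\int_{B(z,r)}f\,dW_\mu$. For a $C^1$ function $\varphi$ and $x\neq 0$ let $\partial_r\varphi(x)=\sum_{j}\frac{x_j}{|x|}\partial_j\varphi(x)$ and $\nabla_0\varphi(x)=|x|\nabla\varphi(x)-x\,\partial_r\varphi(x)$ be the radial derivative and the spherical gradient. Let $U=\{x\in\mathbb{R}^d:0<|x|<1\}$. For $f\in L^2_{\rm loc}(U)$ the derivatives $\partial_r f$ and $\nabla_0 f$ (real- and $\mathbb{R}^d$-valued, respectively), when they exist, are the functions in $L^2_{\rm loc}(U)$, unique up to null sets, such that for all $\varphi\in C^1_c(U)$ $$\int_B \varphi\,\partial_r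 f\,dx=-\int_B f(x)\Big(\partial_r\varphi(x)+\tfrac{d-1}{|x|}\varphi(x)\Big)dx,\qquad \int_B \varphi\,\nabla_0 f\,dx=-\int_B f(x)\Big(\nabla_0\varphi(x)-(d-1)\tfrac{x}{|x|}\varphi(x)\Big)dx .$$ Let $D(\overline{\mathcal E})$ be the set of all $f\in L^2(B,dW_\mu)$ for which $\partial_r f$ and $\nabla_0 f$ exist in this sense, $\sqrt{1-|x|^2}\,\partial_r f$ and $\frac1{|x|}|\nabla_0 f|$ belong to $L^2(B,dW_\mu)$, and there are $f_n\in C^2(B)$ with $f_n\to f$, $\sqrt{1-|x|^2}\,\partial_r(f_n-f)\to0$ and $\frac1{|x|}|\nabla_0(f_n-f)|\to0$ in $L^2(B,dW_\mu)$. For such $f$ put $$\Gamma(f,f)(x)=(1-|x|^2)\,|\partial_r f(x)|^2+\frac1{|x|^2}|\nabla_0 f(x)|^2 .$$ Then there is a constant $C>0$, depending only on $d$ and $\mu$, such that for all $f\in D(\overline{\mathcal E})$, all $z\in B$ and all $r>0$ $$\int_{B(z,r)}|f-f_{B(z,r)}|^2\,dW_\mu\le C\,r^2\int_{B(z,r)}\Gamma(f,f)\,dW_\mu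 .$$ -/

import Mathlib

open MeasureTheory Filter Topology

noncomputable section

namespace BallDirichlet

/-- Euclidean space of dimension `d`. -/
abbrev E (d : ℕ) := EuclideanSpace ℝ (Fin d)

/-- The closed Euclidean unit ball `B`. -/
def unitBall (d : ℕ) : Set (E d) := Metric.closedBall 0 1

/-- The open Euclidean unit ball with the origin removed. -/
def puncturedBall (d : ℕ) : Set (E d) := Metric.ball 0 1 \ {0}

/-- The measure `W_μ(x) dx` on the closed unit ball, `W_μ(x) = (1 - |x|²)^(μ - 1/2)`. -/
def weight (d : ℕ) (μ : ℝ) : Measure (E d) :=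
  (volume.restrict (unitBall d)).withDensity
    (fun x => ENNReal.ofReal ((1 - ‖x‖ ^ 2) ^ (μ - 1 / 2)))

/-- The geodesic distance on `B`. -/
def ballDist {d : ℕ} (x y : E d) : ℝ :=
  Real.arccos (inner ℝ x y + √(1 - ‖x‖ ^ 2) * √(1 - ‖y‖ ^ 2))

/-- The open ball `B(z, r)` for the geodesic distance on `B`. -/
def geoBall {d : ℕ} (z : E d) (r : ℝ) : Set (E d) :=
  {y | y ∈ unitBall d ∧ ballDist z y < r}

/-- The classical radial derivative `∑ⱼ (xⱼ / |x|) ∂ⱼφ(x)`. -/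
def classicalRadial {d : ℕ} (φ : E d → ℝ) (x : E d) : ℝ :=
  fderiv ℝ φ x x / ‖x‖

/-- The classical spherical gradient `|x| ∇φ(x) - x ∂ᵣφ(x)`. -/
def classicalSpherical {d : ℕ} (φ : E d → ℝ) (x : E d) : E d :=
  ‖x‖ • gradient φ x - classicalRadial φ x • x

/-- Test functions: `C¹` functions with compact support in the punctured open ball. -/
def IsTest {d : ℕ} (φ : E d → ℝ) : Prop :=
  ContDiff ℝ 1 φ ∧ HasCompactSupport φ ∧ tsupport φ ⊆ puncturedBall d

/-- Local square integrability in the punctured open ball (with respect to Lebesgue measure). -/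
def MemL2Loc {d : ℕ} {F : Type*} [NormedAddCommGroup F] (f : E d → F) : Prop :=
  ∀ K : Set (E d), IsCompact K → K ⊆ puncturedBall d → MemLp f 2 (volume.restrict K)

/-- `h` is the `L²` distributional radial derivative of `f`. -/
def IsRadialDeriv {d : ℕ} (f h : E d → ℝ) : Prop :=
  MemL2Loc f ∧ MemL2Loc h ∧ ∀ φ : E d → ℝ, IsTest φ →
    ∫ x in unitBall d, h x * φ x =
      -∫ x in unitBall d, f x * (classicalRadial φ x + ((d : ℝ) - 1) / ‖x‖ * φ x)

/-- `h` is the `L²` distributional spherical gradient of `f`. -/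
def IsSphericalGrad {d : ℕ} (f : E d → ℝ) (h : E d → E d) : Prop :=
  MemL2Loc f ∧ MemL2Loc h ∧ ∀ φ : E d → ℝ, IsTest φ →
    ∫ x in unitBall d, φ x • h x =
      -∫ x in unitBall d,
        f x • (classicalSpherical φ x - (((d : ℝ) - 1) * φ x / ‖x‖) • x)

open Classical in
/-- The `L²` radial derivative `∂ᵣf` (a.e. unique where it exists; `0` if it does not exist). -/
def radialDeriv {d : ℕ} (f : E d → ℝ) : E d → ℝ :=
  if H : ∃ h, IsRadialDeriv f h then H.choose else 0

open Classical in
/-- The `L²` spherical gradient of `f` (a.e. unique where it exists; `0` if it does not exist). -/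
def sphericalGrad {d : ℕ} (f : E d → ℝ) : E d → E d :=
  if H : ∃ h, IsSphericalGrad f h then H.choose else 0

/-- The domain of the closed form: `f ∈ L²(B, W_μ)` has `L²` derivatives `∂ᵣf` and `∇₀f` with
`√(1 - |x|²) ∂ᵣf` and `|∇₀f| / |x|` in `L²(B, W_μ)`, and `f` is a limit of functions in `C²(B)`
in the corresponding norm. -/
structure FormDomain (d : ℕ) (μ : ℝ) (f : E d → ℝ) : Prop where
  memLp : MemLp f 2 (weight d μ)
  exists_radial : ∃ h, IsRadialDeriv f h
  exists_spherical : ∃ h, IsSphericalGrad f h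
  memLp_radial : MemLp (fun x => √(1 - ‖x‖ ^ 2) * radialDeriv f x) 2 (weight d μ)
  memLp_spherical : MemLp (fun x => ‖sphericalGrad f x‖ / ‖x‖) 2 (weight d μ)
  approx : ∃ u : ℕ → E d → ℝ, (∀ n, ContDiffOn ℝ 2 (u n) (unitBall d)) ∧
    Tendsto (fun n => eLpNorm (u n - f) 2 (weight d μ)) atTop (𝓝 0) ∧
    Tendsto (fun n => eLpNorm (fun x => √(1 - ‖x‖ ^ 2) * radialDeriv (u n - f) x) 2
      (weight d μ)) atTop (𝓝 0) ∧
    Tendsto (fun n => eLpNorm (fun x => ‖sphericalGrad (u n - f) x‖ / ‖x‖) 2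
      (weight d μ)) atTop (𝓝 0)

/-- The density `Γ(f, g)` of the energy measure with respect to `W_μ(x) dx`. -/
def energyDensity {d : ℕ} (f g : E d → ℝ) (x : E d) : ℝ :=
  (1 - ‖x‖ ^ 2) * (radialDeriv f x * radialDeriv g x) +
    1 / ‖x‖ ^ 2 * inner ℝ (sphericalGrad f x) (sphericalGrad g x)

/-- The mean value of `f` over `S` with respect to `W_μ(x) dx`. -/
def mean {d : ℕ} (μ : ℝ) (f : E d → ℝ) (S : Set (E d)) : ℝ :=
  ((weight d μ).real S)⁻¹ * ∫ x in S, f x ∂(weight d μ)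

end BallDirichlet

end

/-! The map x ↦ (x, √(1-|x|²)) carries B onto the closed upper unit hemisphere of ℝ^d × ℝ. Under it
d_B becomes the spherical distance, W_μ dx becomes η^(2μ) times surface measure, and Γ becomes the
squared tangential gradient. A function on the ball is extended to the half space η > 0
homogeneously of degree zero, and the half space carries the measure η^(2μ) dξ dη. Polar coordinates
(`lintegral_halfMeasure_polar`) translate integral inequalities between ball and half space. The
gain is flatness: segments replace geodesics, dilations and translations are available.

Small radii (cosine at least 1/2). The cone over the geodesic ball, cut to 1 < ⟨z,X⟩ < 1+r, is
convex with diameter O(r). On a convex set K the difference u(X)-u(Y) is controlled by the energy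
along the segment XY, and the segment is split at its midpoint so that each half is integrated over
its nearer endpoint (`exists_poincare_convex`). For fixed Y, the map X ↦ (1-τ)X+τY with τ ≤ 1/2 is a
dilation of ratio at least 1/2 followed by an upward translation. Averages over upward translates
are bounded because η^a with a = 2μ > -1 is integrable at 0 (`lintegral_halfMeasure_translate`). No
Muckenhoupt or doubling theory is needed.

Large radii. The cone may fail to be convex, but it is stable under translation by the point above
z, and a translation of bounded length moves all points of norm less than 2 into the cone of cosine
1/2. Thus the deviation on the large cap is bounded by the energy and the deviation on a fixed small
cap (`lintegral_cap_le_of_cap_half`). Here r ≥ 1, so the factor r² costs nothing.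

Form domain. For C¹ functions the distributional derivatives are the classical ones, so the
inequality for smooth functions holds for f up to approximation errors that tend to zero. The free
constant k is replaced by the mean, which minimizes the square deviation, before the limit is taken.
-/

namespace BallDirichlet

variable {d : ℕ}

/-! ### The half space over the ball: central projection and polar coordinates. -/

/-- The height `√(1 - |x|²)` of the point of the upper hemisphere above `x`. -/
noncomputable def height (x : E d) : ℝ := √(1 - ‖x‖ ^ 2)

/-- The Euclidean norm on `E d × ℝ`. -/
noncomputable def coneNorm (X : E d × ℝ) : ℝ := √(‖X.1‖ ^ 2 + X.2 ^ 2)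

/-- The measure `η ^ a dξ dη` on the upper half space `η > 0`. -/
noncomputable def halfMeasure (d : ℕ) (a : ℝ) : Measure (E d × ℝ) :=
  (volume.restrict {X | 0 < X.2}).withDensity (fun X => ENNReal.ofReal (X.2 ^ a))

lemma one_sub_sq_pos {x : E d} (hx : x ∈ Metric.ball (0 : E d) 1) : 0 < 1 - ‖x‖ ^ 2 := by
  have : ‖x‖ < 1 := by simpa using hx
  nlinarith [norm_nonneg x]

lemma height_pos {x : E d} (hx : x ∈ Metric.ball (0 : E d) 1) : 0 < height x :=
  Real.sqrt_pos.2 (one_sub_sq_pos hx)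

lemma height_sq {x : E d} (hx : x ∈ Metric.closedBall (0 : E d) 1) :
    height x ^ 2 = 1 - ‖x‖ ^ 2 := by
  have : ‖x‖ ≤ 1 := by simpa using hx
  exact Real.sq_sqrt (by nlinarith [norm_nonneg x])

lemma height_nonneg (x : E d) : 0 ≤ height x := Real.sqrt_nonneg _

@[fun_prop]
lemma continuous_height : Continuous (height (d := d)) := by
  unfold height; fun_prop

@[fun_prop]
lemma continuous_coneNorm : Continuous (coneNorm (d := d)) := by
  unfold coneNorm; fun_prop

@[fun_prop]
lemma measurable_height : Measurable (height (d := d)) := continuous_height.measurable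

@[fun_prop]
lemma measurable_coneNorm : Measurable (coneNorm (d := d)) := continuous_coneNorm.measurable

lemma ball_ae_eq_unitBall (d : ℕ) :
    (Metric.ball (0 : E d) 1 : Set (E d)) =ᵐ[volume] unitBall d :=
  ae_eq_of_subset_of_measure_ge Metric.ball_subset_closedBall
    (Measure.addHaar_unitClosedBall_eq_addHaar_unitBall _).le
    measurableSet_ball.nullMeasurableSet (isCompact_closedBall _ _).measure_ne_top

/-- The map is the central projection of the hemisphere, parametrized by the ball, onto the
hyperplane at height η. Its derivative is written as a multiple of a transvection because the
determinant can then be read off. -/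
lemma hasFDerivAt_gnomonic (η : ℝ) {x : E d} (hx : x ∈ Metric.ball (0 : E d) 1) :
    HasFDerivAt (fun y : E d => (η / height y) • y)
      ((η / height x) • (LinearMap.transvection
        ((1 / height x ^ 2) • (innerSL ℝ x : E d →ₗ[ℝ] ℝ)) x).toContinuousLinearMap) x := by
  have hpos := one_sub_sq_pos hx
  have hh := height_pos hx
  have h1 : HasFDerivAt (fun y : E d => 1 - ‖y‖ ^ 2) (-(2 • innerSL ℝ x)) x :=
    ((hasStrictFDerivAt_norm_sq x).hasFDerivAt).const_sub 1
  have h2 := (h1.sqrt hpos.ne')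
  have h3 : HasFDerivAt (fun y : E d => η / height y)
      ((η / height x ^ 3) • innerSL ℝ x) x := by
    have h4 := ((hasDerivAt_inv hh.ne').comp_hasFDerivAt x h2).const_mul η
    refine (h4.congr_fderiv ?_).congr_of_eventuallyEq
      (Eventually.of_forall fun y => by simp [div_eq_mul_inv, height])
    ext v
    simp only [height] at hh ⊢
    simp
    field_simp
  refine (h3.smul (hasFDerivAt_id x)).congr_fderiv ?_
  ext1 v
  simp [LinearMap.transvection, smul_smul]
  congr 1
  field_simp

lemma det_gnomonic (η : ℝ) {x : E d} (hx : x ∈ Metric.ball (0 : E d) 1) :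
    ((η / height x) • (LinearMap.transvection
        ((1 / height x ^ 2) • (innerSL ℝ x : E d →ₗ[ℝ] ℝ)) x).toContinuousLinearMap :
        E d →L[ℝ] E d).det = (η / height x) ^ d * (1 / height x ^ 2) := by
  have hh := height_pos hx
  have h2 := height_sq (Metric.ball_subset_closedBall hx)
  have : (((η / height x) • (LinearMap.transvection
        ((1 / height x ^ 2) • (innerSL ℝ x : E d →ₗ[ℝ] ℝ)) x).toContinuousLinearMap :
        E d →L[ℝ] E d) : E d →ₗ[ℝ] E d) = (η / height x) • (LinearMap.transvection
        ((1 / height x ^ 2) • (innerSL ℝ x : E d →ₗ[ℝ] ℝ)) x) := by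
    ext; simp
  rw [ContinuousLinearMap.det, this, LinearMap.det_smul, LinearMap.transvection.det]
  simp
  left
  field_simp
  linarith

lemma gnomonic_leftInv {η : ℝ} (hη : 0 < η) {x : E d} (hx : x ∈ Metric.ball (0 : E d) 1) :
    (1 / √(η ^ 2 + ‖(η / height x) • x‖ ^ 2)) • ((η / height x) • x) = x := by
  have hh := height_pos hx
  have h2 := height_sq (Metric.ball_subset_closedBall hx)
  have : η ^ 2 + ‖(η / height x) • x‖ ^ 2 = (η / height x) ^ 2 := by
    rw [norm_smul, mul_pow, Real.norm_eq_abs, sq_abs]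
    field_simp
    linarith
  rw [this, Real.sqrt_sq (by positivity), smul_smul]
  have : 1 / (η / height x) * (η / height x) = 1 := by field_simp
  rw [this, one_smul]

lemma gnomonic_image {η : ℝ} (hη : 0 < η) :
    (fun y : E d => (η / height y) • y) '' Metric.ball 0 1 = Set.univ := by
  refine Set.eq_univ_of_forall fun ξ => ?_
  have hS : 0 < η ^ 2 + ‖ξ‖ ^ 2 := by positivity
  have hn : ‖(1 / √(η ^ 2 + ‖ξ‖ ^ 2)) • ξ‖ ^ 2 = ‖ξ‖ ^ 2 / (η ^ 2 + ‖ξ‖ ^ 2) := by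
    rw [norm_smul, mul_pow, Real.norm_eq_abs, sq_abs, div_pow, Real.sq_sqrt hS.le]
    ring
  have hH : height ((1 / √(η ^ 2 + ‖ξ‖ ^ 2)) • ξ) = η / √(η ^ 2 + ‖ξ‖ ^ 2) := by
    rw [height, hn]
    have : 1 - ‖ξ‖ ^ 2 / (η ^ 2 + ‖ξ‖ ^ 2) = η ^ 2 / (η ^ 2 + ‖ξ‖ ^ 2) := by field_simp; ring
    rw [this, Real.sqrt_div (by positivity), Real.sqrt_sq hη.le]
  refine ⟨(1 / √(η ^ 2 + ‖ξ‖ ^ 2)) • ξ, ?_, ?_⟩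
  · rw [mem_ball_zero_iff, ← sq_lt_one_iff₀ (norm_nonneg _), hn, div_lt_one hS]
    have := pow_pos hη 2
    linarith
  · have h0 := Real.sqrt_pos.2 hS
    simp only [hH, smul_smul]
    have : η / (η / √(η ^ 2 + ‖ξ‖ ^ 2)) * (1 / √(η ^ 2 + ‖ξ‖ ^ 2)) = 1 := by field_simp
    rw [this, one_smul]

lemma lintegral_gnomonic {η : ℝ} (hη : 0 < η) (φ : E d → ENNReal) :
    ∫⁻ ξ, φ ξ = ∫⁻ x in Metric.ball (0 : E d) 1,
      ENNReal.ofReal ((η / height x) ^ d * (1 / height x ^ 2)) * φ ((η / height x) • x) := by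
  have := lintegral_image_eq_lintegral_abs_det_fderiv_mul (volume : Measure (E d))
    (measurableSet_ball (x := (0 : E d)) (ε := 1))
    (fun x hx => (hasFDerivAt_gnomonic η hx).hasFDerivWithinAt)
    (fun x hx y hy h => by
      rw [← gnomonic_leftInv hη hx, ← gnomonic_leftInv hη hy]
      simp only at h
      rw [h]) φ
  rw [gnomonic_image hη, setLIntegral_univ] at this
  rw [this]
  refine setLIntegral_congr_fun measurableSet_ball fun x hx => ?_
  have hh := height_pos hx
  simp only
  rw [det_gnomonic η hx, abs_of_nonneg (by positivity)]

lemma lintegral_Ioi_scale {h : ℝ} (hh : 0 < h) (φ : ℝ → ENNReal) :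
    ∫⁻ η in Set.Ioi 0, φ η = ∫⁻ ρ in Set.Ioi 0, ENNReal.ofReal h * φ (ρ * h) := by
  have := lintegral_image_eq_lintegral_abs_det_fderiv_mul (volume : Measure ℝ)
    (measurableSet_Ioi (a := (0 : ℝ))) (f := fun ρ => ρ * h)
    (f' := fun _ => ContinuousLinearMap.toSpanSingleton ℝ h)
    (fun x _ => by
      simpa using ((hasDerivAt_id x).mul_const h).hasFDerivAt.hasFDerivWithinAt)
    (fun x _ y _ hxy => mul_right_cancel₀ hh.ne' hxy) φ
  have himg : (fun ρ : ℝ => ρ * h) '' Set.Ioi 0 = Set.Ioi 0 := by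
    ext y
    constructor
    · rintro ⟨x, hx, rfl⟩
      exact mul_pos hx hh
    · intro hy
      exact ⟨y / h, div_pos hy hh, by field_simp⟩
  rw [himg] at this
  rw [this]
  simp [ContinuousLinearMap.det, abs_of_pos hh]

/-- Integration in polar coordinates over the upper half space: the spherical variable is
parametrized by the unit ball. -/
theorem lintegral_halfMeasure_polar (μ : ℝ) {ψ : E d × ℝ → ENNReal} (hψ : Measurable ψ) :
    ∫⁻ X, ψ X ∂(halfMeasure d (2 * μ)) = ∫⁻ x, (∫⁻ ρ in Set.Ioi (0 : ℝ),
      ψ (ρ • x, ρ * height x) * ENNReal.ofReal (ρ ^ (d + 2 * μ))) ∂(weight d μ) := by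
  have hm : MeasurableSet {X : E d × ℝ | 0 < X.2} := measurableSet_lt (by fun_prop) (by fun_prop)
  have hset : {X : E d × ℝ | 0 < X.2} = Set.univ ×ˢ Set.Ioi 0 := by ext; simp
  rw [halfMeasure, lintegral_withDensity_eq_lintegral_mul _ (by fun_prop) hψ, hset,
    Measure.volume_eq_prod, ← Measure.prod_restrict, lintegral_prod_symm' _ (by fun_prop)]
  have h1 : ∀ η ∈ Set.Ioi (0 : ℝ), (∫⁻ ξ in Set.univ, ((fun X : E d × ℝ =>
      ENNReal.ofReal (X.2 ^ (2 * μ))) * ψ) (ξ, η)) = ∫⁻ x in Metric.ball (0 : E d) 1,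
      ENNReal.ofReal ((η / height x) ^ d * (1 / height x ^ 2)) *
        (ENNReal.ofReal (η ^ (2 * μ)) * ψ ((η / height x) • x, η)) := by
    intro η hη
    rw [setLIntegral_univ, lintegral_gnomonic hη]
    rfl
  rw [setLIntegral_congr_fun measurableSet_Ioi h1, lintegral_lintegral_swap (by fun_prop)]
  rw [weight, lintegral_withDensity_eq_lintegral_mul₀ (by fun_prop)
    (by
      refine (Measurable.lintegral_prod_right' (f := fun p : E d × ℝ =>
        ψ (p.2 • p.1, p.2 * height p.1) * ENNReal.ofReal (p.2 ^ ((d:ℝ) + 2 * μ))) ?_).aemeasurable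
      fun_prop)]
  rw [← Measure.restrict_congr_set (ball_ae_eq_unitBall d)]
  refine setLIntegral_congr_fun measurableSet_ball fun x hx => ?_
  have hh := height_pos hx
  simp only [Pi.mul_apply]
  rw [lintegral_Ioi_scale hh, ← lintegral_const_mul' _ _ ENNReal.ofReal_ne_top]
  refine setLIntegral_congr_fun measurableSet_Ioi fun ρ hρ => ?_
  have hρ' : 0 < ρ := hρ
  have e1 : ρ * height x / height x = ρ := by field_simp
  simp only [e1]
  -- The powers of the height h now match: the projection contributes ρ^d h⁻², the substitution η =
  -- ρh contributes h, and the weight contributes (ρh)^(2μ). The product is ρ^(d+2μ) h^(2μ-1), which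
  -- is the density W_μ times the radial factor.
  have e2 : (1 - ‖x‖ ^ 2) ^ (μ - 1 / 2) = height x ^ (2 * μ) * (height x)⁻¹ := by
    rw [← height_sq (Metric.ball_subset_closedBall hx), ← Real.rpow_natCast, ← Real.rpow_mul hh.le,
      ← Real.rpow_neg_one, ← Real.rpow_add hh]
    congr 1
    push_cast
    ring
  rw [e2, Real.mul_rpow hρ'.le hh.le, Real.rpow_add hρ', Real.rpow_natCast]
  rw [mul_comm (ψ _), ← mul_assoc, ← mul_assoc, ← mul_assoc, ← ENNReal.ofReal_mul (by positivity),
    ← ENNReal.ofReal_mul (by positivity), ← ENNReal.ofReal_mul (by positivity)]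
  congr 2
  field_simp

/-! ### Averages along translates and segments in the weighted half space. -/

/-- The one-dimensional density `η ^ a` on `η > 0`, extended by zero. -/
noncomputable def halfDensity (a η : ℝ) : ENNReal := if 0 < η then ENNReal.ofReal (η ^ a) else 0

@[fun_prop]
lemma measurable_halfDensity (a : ℝ) : Measurable (halfDensity a) :=
  Measurable.ite measurableSet_Ioi (by fun_prop) measurable_const

lemma measurableSet_halfSpace : MeasurableSet {X : E d × ℝ | 0 < X.2} :=
  measurableSet_lt (by fun_prop) (by fun_prop)

lemma lintegral_halfMeasure (a : ℝ) {ψ : E d × ℝ → ENNReal} (hψ : Measurable ψ) :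
    ∫⁻ X, ψ X ∂(halfMeasure d a) = ∫⁻ X, halfDensity a X.2 * ψ X := by
  rw [halfMeasure, lintegral_withDensity_eq_lintegral_mul _ (by fun_prop) hψ,
    ← lintegral_indicator measurableSet_halfSpace]
  refine lintegral_congr fun X => ?_
  by_cases h : 0 < X.2 <;> simp [halfDensity, h]

/-- The constant in the bound for averages of `halfDensity` over translates. -/
noncomputable def translateConst (a : ℝ) : ℝ := 2 + 2 / (a + 1)

lemma translateConst_pos {a : ℝ} (ha : -1 < a) : 0 < translateConst a := by
  have : 0 < a + 1 := by linarith
  unfold translateConst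
  positivity

lemma lintegral_rpow_sub_mul {a : ℝ} (ha : -1 < a) {h κ : ℝ} (hh : 0 < h) (hκ : 0 < κ) :
    ∫⁻ τ in Set.Ioc 0 (h / κ), ENNReal.ofReal ((h - κ * τ) ^ a) =
      ENNReal.ofReal (h ^ (a + 1) / (κ * (a + 1))) := by
  have hle : (0 : ℝ) ≤ h / κ := by positivity
  have hint : IntervalIntegrable (fun τ => (h - κ * τ) ^ a) volume 0 (h / κ) := by
    have := ((intervalIntegral.intervalIntegrable_rpow' (a := h) (b := 0) ha).comp_sub_left h)
    have h2 := this.comp_mul_left (c := κ)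
    simpa [mul_comm κ] using h2
  have hval : ∫ τ in (0 : ℝ)..(h / κ), (h - κ * τ) ^ a = h ^ (a + 1) / (κ * (a + 1)) := by
    rw [intervalIntegral.integral_comp_sub_mul (fun x => x ^ a) hκ.ne']
    have e : h - κ * (h / κ) = 0 := by field_simp; simp
    rw [e, mul_zero, sub_zero, integral_rpow (Or.inl ha), Real.zero_rpow (by linarith)]
    simp only [sub_zero, smul_eq_mul]
    field_simp
  rw [← hval, intervalIntegral.integral_of_le hle, ofReal_integral_eq_lintegral_ofReal]
  · exact (intervalIntegrable_iff_integrableOn_Ioc_of_le hle).1 hint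
  · filter_upwards [ae_restrict_mem measurableSet_Ioc] with τ hτ
    refine Real.rpow_nonneg ?_ _
    have := (le_div_iff₀ hκ).1 hτ.2
    linarith

/-- For a ≥ 0 lowering the point decreases the density. For -1 < a < 0 and h ≥ 2Tκ the shifted
height stays above h/2, and the density grows by at most 2^(-a) ≤ 2. Otherwise the shift may reach
the boundary where the density blows up, and no pointwise bound is possible; the full integral
h^(a+1)/(κ(a+1)) is then at most 2T h^a/(a+1), since h < 2Tκ. The two summands of `translateConst`
come from these cases. -/
lemma lintegral_halfDensity_translate {a : ℝ} (ha : -1 < a) {κ T : ℝ} (hκ : 0 ≤ κ) (hT : 0 < T)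
    (h : ℝ) :
    ∫⁻ τ in Set.Ioc 0 T, halfDensity a (h - τ * κ) ≤
      ENNReal.ofReal (translateConst a * T) * halfDensity a h := by
  have ha1 : 0 < a + 1 := by linarith
  have hC : 2 ≤ translateConst a := by
    unfold translateConst
    have : 0 ≤ 2 / (a + 1) := by positivity
    linarith
  rcases le_or_gt h 0 with hh | hh
  · have : ∀ τ ∈ Set.Ioc 0 T, halfDensity a (h - τ * κ) = 0 := fun τ hτ => by
      have : 0 ≤ τ * κ := mul_nonneg hτ.1.le hκ
      simp only [halfDensity]
      rw [if_neg (by linarith)]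
    rw [setLIntegral_congr_fun measurableSet_Ioc this]
    simp
  have hden : halfDensity a h = ENNReal.ofReal (h ^ a) := by simp [halfDensity, hh]
  -- pointwise bound on the integrand suffices in the easy cases
  have easy : (∀ τ ∈ Set.Ioc 0 T, 0 < h - τ * κ → (h - τ * κ) ^ a ≤ 2 * h ^ a) →
      ∫⁻ τ in Set.Ioc 0 T, halfDensity a (h - τ * κ) ≤
      ENNReal.ofReal (translateConst a * T) * halfDensity a h := by
    intro hb
    calc ∫⁻ τ in Set.Ioc 0 T, halfDensity a (h - τ * κ)
        ≤ ∫⁻ τ in Set.Ioc 0 T, ENNReal.ofReal (2 * h ^ a) := by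
          refine setLIntegral_mono measurable_const fun τ hτ => ?_
          unfold halfDensity
          split_ifs with hp
          · exact ENNReal.ofReal_le_ofReal (hb τ hτ hp)
          · simp
      _ = ENNReal.ofReal (2 * T) * ENNReal.ofReal (h ^ a) := by
          rw [setLIntegral_const, Real.volume_Ioc, ← ENNReal.ofReal_mul (by positivity),
            ← ENNReal.ofReal_mul (by positivity)]
          congr 1; ring
      _ ≤ _ := by
          rw [hden]
          gcongr
  rcases le_or_gt 0 a with ha0 | ha0
  · refine easy fun τ hτ hp => ?_
    have : 0 ≤ τ * κ := mul_nonneg hτ.1.le hκ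
    have h1 : (h - τ * κ) ^ a ≤ h ^ a := Real.rpow_le_rpow hp.le (by linarith) ha0
    have := Real.rpow_nonneg hh.le a
    linarith
  rcases le_or_gt (2 * T * κ) h with hbig | hsmall
  · refine easy fun τ hτ hp => ?_
    have h0 : h / 2 ≤ h - τ * κ := by nlinarith [hτ.2]
    have h1 : (h - τ * κ) ^ a ≤ (h / 2) ^ a :=
      Real.rpow_le_rpow_of_nonpos (by positivity) h0 ha0.le
    have h2 : (h / 2) ^ a = h ^ a * 2 ^ (-a) := by
      rw [Real.div_rpow hh.le (by norm_num), Real.rpow_neg (by norm_num)]; rfl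
    have h3 : (2 : ℝ) ^ (-a) ≤ 2 := by
      calc (2 : ℝ) ^ (-a) ≤ 2 ^ (1 : ℝ) :=
            Real.rpow_le_rpow_of_exponent_le (by norm_num) (by linarith)
        _ = 2 := by simp
    have := Real.rpow_nonneg hh.le a
    nlinarith
  · have hκ0 : 0 < κ := by
      rcases hκ.eq_or_lt with h0 | h0
      · rw [← h0] at hsmall; linarith
      · exact h0
    calc ∫⁻ τ in Set.Ioc 0 T, halfDensity a (h - τ * κ)
        ≤ ∫⁻ τ in Set.Ioi 0, halfDensity a (h - τ * κ) :=
          lintegral_mono_set Set.Ioc_subset_Ioi_self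
      _ ≤ ∫⁻ τ in Set.Ioc 0 (h / κ), ENNReal.ofReal ((h - κ * τ) ^ a) := by
          rw [← lintegral_indicator measurableSet_Ioi, ← lintegral_indicator measurableSet_Ioc]
          refine lintegral_mono fun τ => ?_
          by_cases h0 : 0 < τ
          · by_cases hp : 0 < h - τ * κ
            · have : τ ≤ h / κ := by rw [le_div_iff₀ hκ0]; linarith
              rw [Set.indicator_of_mem (Set.mem_Ioi.2 h0),
                Set.indicator_of_mem (Set.mem_Ioc.2 ⟨h0, this⟩),
                halfDensity, if_pos hp, mul_comm]
            · rw [Set.indicator_of_mem (Set.mem_Ioi.2 h0), halfDensity, if_neg hp]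
              exact zero_le
          · simp [h0]
      _ = ENNReal.ofReal (h ^ (a + 1) / (κ * (a + 1))) := lintegral_rpow_sub_mul ha hh hκ0
      _ ≤ _ := by
          rw [hden, ← ENNReal.ofReal_mul (by have := translateConst_pos ha; positivity)]
          refine ENNReal.ofReal_le_ofReal ?_
          rw [Real.rpow_add hh, Real.rpow_one, div_le_iff₀ (by positivity)]
          have hp := Real.rpow_pos_of_pos hh a
          have e : translateConst a * T * h ^ a * (κ * (a + 1)) =
              h ^ a * (T * κ * (2 * (a + 1) + 2)) := by
            unfold translateConst; field_simp
          rw [e]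
          refine mul_le_mul_of_nonneg_left ?_ hp.le
          have : 0 ≤ T * κ * (2 * (a + 1)) := by positivity
          linarith

instance (d : ℕ) : (volume : Measure (E d × ℝ)).IsAddHaarMeasure :=
  inferInstanceAs (((volume : Measure (E d)).prod (volume : Measure ℝ)).IsAddHaarMeasure)

instance (d : ℕ) (a : ℝ) : SFinite (halfMeasure d a) := by
  unfold halfMeasure; infer_instance

/-- Averages over translates in an upward direction are bounded with respect to `η ^ a dξ dη`. -/
theorem lintegral_halfMeasure_translate {a : ℝ} (ha : -1 < a) {V : E d × ℝ} (hV : 0 ≤ V.2) {T : ℝ}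
    (hT : 0 < T) {g : E d × ℝ → ENNReal} (hg : Measurable g) :
    ∫⁻ X, (∫⁻ τ in Set.Ioc 0 T, g (X + τ • V)) ∂(halfMeasure d a) ≤
      ENNReal.ofReal (translateConst a * T) * ∫⁻ X, g X ∂(halfMeasure d a) := by
  have hm : Measurable fun p : (E d × ℝ) × ℝ => g (p.1 + p.2 • V) := by fun_prop
  rw [lintegral_halfMeasure a hm.lintegral_prod_right', lintegral_halfMeasure a hg]
  calc ∫⁻ X, halfDensity a X.2 * ∫⁻ τ in Set.Ioc 0 T, g (X + τ • V)
      = ∫⁻ X, ∫⁻ τ in Set.Ioc 0 T, halfDensity a X.2 * g (X + τ • V) :=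
        lintegral_congr fun X => (lintegral_const_mul _ (by fun_prop)).symm
    _ = ∫⁻ τ in Set.Ioc 0 T, ∫⁻ X : E d × ℝ, halfDensity a X.2 * g (X + τ • V) :=
        lintegral_lintegral_swap (by fun_prop)
    -- Translation invariance of Lebesgue measure moves the shift from g to the density, so that
    -- only a one-dimensional average of the density remains.
    _ = ∫⁻ τ in Set.Ioc 0 T, ∫⁻ X : E d × ℝ, halfDensity a (X.2 - τ * V.2) * g X := by
        refine lintegral_congr fun τ => ?_
        rw [← lintegral_add_right_eq_self (fun X : E d × ℝ =>
          halfDensity a (X.2 - τ * V.2) * g X) (τ • V)]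
        simp
    _ = ∫⁻ X : E d × ℝ, ∫⁻ τ in Set.Ioc 0 T, halfDensity a (X.2 - τ * V.2) * g X :=
        lintegral_lintegral_swap (by fun_prop)
    _ ≤ ∫⁻ X : E d × ℝ, ENNReal.ofReal (translateConst a * T) * (halfDensity a X.2 * g X) := by
        refine lintegral_mono fun X => ?_
        rw [lintegral_mul_const _ (by fun_prop), ← mul_assoc]
        gcongr
        exact lintegral_halfDensity_translate ha hV hT _
    _ = _ := lintegral_const_mul _ (by fun_prop)

/-- Substituting s • X costs s^(-(d+1)) from Lebesgue measure and s^(-a) from the density. The total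
exponent d+1+a is positive, so s = 1/2 is the worst case. -/
lemma lintegral_halfMeasure_smul_le {a : ℝ} (ha : -1 < a) {s : ℝ} (hs : 1 / 2 ≤ s)
    {g : E d × ℝ → ENNReal} (hg : Measurable g) :
    ∫⁻ X, g (s • X) ∂(halfMeasure d a) ≤
      ENNReal.ofReal (2 ^ (d + 1 + a)) * ∫⁻ X, g X ∂(halfMeasure d a) := by
  have hs0 : 0 < s := by linarith
  rw [lintegral_halfMeasure a (by fun_prop), lintegral_halfMeasure a hg]
  have hfr : Module.finrank ℝ (E d × ℝ) = d + 1 := by simp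
  have hmap := Measure.map_addHaar_smul (volume : Measure (E d × ℝ)) hs0.ne'
  calc ∫⁻ X : E d × ℝ, halfDensity a X.2 * g (s • X)
      = ∫⁻ X : E d × ℝ, halfDensity a (s⁻¹ * (s • X).2) * g (s • X) := by
        refine lintegral_congr fun X => ?_
        simp [hs0.ne']
    _ = ∫⁻ X, halfDensity a (s⁻¹ * X.2) * g X ∂(Measure.map (s • ·) volume) := by
        rw [lintegral_map (by fun_prop) (by fun_prop)]
    _ = ENNReal.ofReal (s ^ (d + 1))⁻¹ * ∫⁻ X : E d × ℝ, halfDensity a (s⁻¹ * X.2) * g X := by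
        rw [hmap, lintegral_smul_measure, hfr, abs_of_pos (by positivity), smul_eq_mul]
    _ = ENNReal.ofReal (s ^ (d + 1))⁻¹ * ∫⁻ X : E d × ℝ, ENNReal.ofReal (s⁻¹ ^ a) *
          (halfDensity a X.2 * g X) := by
        congr 1
        refine lintegral_congr fun X => ?_
        rw [← mul_assoc]
        congr 1
        unfold halfDensity
        by_cases h : 0 < X.2
        · rw [if_pos (by positivity), if_pos h, ← ENNReal.ofReal_mul (by positivity),
            Real.mul_rpow (by positivity) h.le]
        · rw [if_neg h, if_neg, mul_zero]
          rw [not_lt] at h ⊢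
          exact mul_nonpos_of_nonneg_of_nonpos (by positivity) h
    _ = ENNReal.ofReal ((s ^ (d + 1))⁻¹ * s⁻¹ ^ a) *
          ∫⁻ X : E d × ℝ, halfDensity a X.2 * g X := by
        rw [lintegral_const_mul _ (by fun_prop), ← mul_assoc, ← ENNReal.ofReal_mul (by positivity)]
    _ ≤ _ := by
        gcongr
        have e : (s ^ (d + 1))⁻¹ * s⁻¹ ^ a = s⁻¹ ^ ((d : ℝ) + 1 + a) := by
          rw [Real.rpow_add (by positivity), ← inv_pow, ← Real.rpow_natCast s⁻¹ (d + 1)]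
          push_cast
          rfl
        rw [e]
        refine Real.rpow_le_rpow (by positivity) ?_ ?_
        · rw [inv_le_comm₀ hs0 (by norm_num)]; linarith
        · have : (0 : ℝ) ≤ d := by positivity
          linarith

/-- Averages over the half, near the integration variable, of the segments to a fixed point are
bounded with respect to `η ^ a dξ dη`. -/
theorem lintegral_halfMeasure_segment {a : ℝ} (ha : -1 < a) {Y : E d × ℝ} (hY : 0 ≤ Y.2)
    {g : E d × ℝ → ENNReal} (hg : Measurable g) :
    ∫⁻ X, (∫⁻ τ in Set.Ioc 0 (1 / 2 : ℝ), g (X + τ • (Y - X))) ∂(halfMeasure d a) ≤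
      ENNReal.ofReal (2 ^ (d + 1 + a) * (translateConst a * (1 / 2))) *
        ∫⁻ X, g X ∂(halfMeasure d a) := by
  calc ∫⁻ X, (∫⁻ τ in Set.Ioc 0 (1 / 2 : ℝ), g (X + τ • (Y - X))) ∂(halfMeasure d a)
      = ∫⁻ τ in Set.Ioc 0 (1 / 2 : ℝ), (∫⁻ X, g (X + τ • (Y - X)) ∂(halfMeasure d a)) :=
        lintegral_lintegral_swap (by fun_prop)
    -- The point on the segment is (1-τ)X + τY, and τ ≤ 1/2 keeps the dilation ratio 1-τ away from
    -- zero. This is why only the half of the segment near X is used.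
    _ ≤ ∫⁻ τ in Set.Ioc 0 (1 / 2 : ℝ), ENNReal.ofReal (2 ^ (d + 1 + a)) *
          (∫⁻ X, g (X + τ • Y) ∂(halfMeasure d a)) := by
        refine lintegral_mono_ae ?_
        filter_upwards [ae_restrict_mem measurableSet_Ioc] with τ hτ
        have := lintegral_halfMeasure_smul_le (d := d) ha (s := 1 - τ) (by linarith [hτ.2])
          (g := fun X => g (X + τ • Y)) (by fun_prop)
        refine le_trans (le_of_eq ?_) this
        refine lintegral_congr fun X => ?_
        congr 1
        module
    _ = ENNReal.ofReal (2 ^ (d + 1 + a)) * ∫⁻ X, (∫⁻ τ in Set.Ioc 0 (1 / 2 : ℝ),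
          g (X + τ • Y)) ∂(halfMeasure d a) := by
        rw [lintegral_const_mul, lintegral_lintegral_swap (by fun_prop)]
        have hm : Measurable fun p : ℝ × (E d × ℝ) => g (p.2 + p.1 • Y) := by fun_prop
        exact hm.lintegral_prod_right'
    _ ≤ _ := by
        rw [ENNReal.ofReal_mul (by positivity), mul_assoc]
        gcongr
        exact lintegral_halfMeasure_translate ha hY (by norm_num) hg

/-! ### The degree zero extension and its energy along segments. -/

/-- The point of the unit ball under the radial projection of `X` to the upper hemisphere. -/
noncomputable def coneProj (X : E d × ℝ) : E d := (coneNorm X)⁻¹ • X.1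

/-- The energy density of a differentiable function on the ball, in terms of its differential. -/
noncomputable def gradSq (u : E d → ℝ) (x : E d) : ℝ :=
  ‖fderiv ℝ u x‖ ^ 2 - (fderiv ℝ u x x) ^ 2

lemma coneNorm_nonneg (X : E d × ℝ) : 0 ≤ coneNorm X := Real.sqrt_nonneg _

lemma coneNorm_sq (X : E d × ℝ) : coneNorm X ^ 2 = ‖X.1‖ ^ 2 + X.2 ^ 2 :=
  Real.sq_sqrt (by positivity)

lemma coneNorm_pos {X : E d × ℝ} (h : 0 < X.2) : 0 < coneNorm X := Real.sqrt_pos.2 (by positivity)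

lemma norm_coneProj_sq {X : E d × ℝ} (h : 0 < X.2) :
    ‖coneProj X‖ ^ 2 = 1 - (X.2 / coneNorm X) ^ 2 := by
  have hN := coneNorm_pos h
  have h2 := coneNorm_sq X
  rw [coneProj, norm_smul, mul_pow, Real.norm_eq_abs, sq_abs]
  field_simp
  linarith

lemma coneProj_mem {X : E d × ℝ} (h : 0 < X.2) : coneProj X ∈ Metric.ball (0 : E d) 1 := by
  have hN := coneNorm_pos h
  rw [mem_ball_zero_iff, ← sq_lt_one_iff₀ (norm_nonneg _), norm_coneProj_sq h]
  have : 0 < (X.2 / coneNorm X) ^ 2 := by positivity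
  linarith

lemma height_coneProj {X : E d × ℝ} (h : 0 < X.2) : height (coneProj X) = X.2 / coneNorm X := by
  have hN := coneNorm_pos h
  rw [height, norm_coneProj_sq h, sub_sub_cancel, Real.sqrt_sq (by positivity)]

lemma coneNorm_polar {x : E d} (hx : x ∈ Metric.closedBall (0 : E d) 1) {ρ : ℝ} (hρ : 0 ≤ ρ) :
    coneNorm (ρ • x, ρ * height x) = ρ := by
  have h2 := height_sq hx
  have : ‖ρ • x‖ ^ 2 + (ρ * height x) ^ 2 = ρ ^ 2 := by
    rw [norm_smul, mul_pow, Real.norm_eq_abs, sq_abs]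
    linear_combination ρ ^ 2 * h2
  rw [coneNorm, this, Real.sqrt_sq hρ]

lemma coneProj_polar {x : E d} (hx : x ∈ Metric.closedBall (0 : E d) 1) {ρ : ℝ} (hρ : 0 < ρ) :
    coneProj (ρ • x, ρ * height x) = x := by
  rw [coneProj, coneNorm_polar hx hρ.le]
  simp [smul_smul, hρ.ne']

@[fun_prop]
lemma measurable_coneProj : Measurable (coneProj (d := d)) := by
  unfold coneProj; fun_prop

@[fun_prop]
lemma measurable_gradSq (u : E d → ℝ) : Measurable (gradSq u) := by
  unfold gradSq
  have h1 := measurable_fderiv ℝ u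
  have h2 : Measurable fun x => fderiv ℝ u x x := by
    have : Continuous fun p : (E d →L[ℝ] ℝ) × E d => p.1 p.2 := by fun_prop
    exact this.measurable.comp (h1.prodMk measurable_id)
  fun_prop

/-- Let p represent L and put b = ⟨p,x⟩, h = `height x`. The left side is the square of the inner
product of (v,k) with (p - bx, -bh), the projection of (p,0) onto the tangent space of the sphere at
(x,h). The squared length of that vector is ‖L‖² - (L x)², so the bound is Cauchy–Schwarz. -/
lemma sq_apply_le_gradSq (L : E d →L[ℝ] ℝ) {x : E d} (hx : x ∈ Metric.ball (0 : E d) 1) (v : E d)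
    (k : ℝ) :
    (L (v - (inner ℝ x v + height x * k) • x)) ^ 2 ≤
      (‖L‖ ^ 2 - (L x) ^ 2) * (‖v‖ ^ 2 + k ^ 2) := by
  have hh := height_sq (Metric.ball_subset_closedBall hx)
  set p := (InnerProductSpace.toDual ℝ (E d)).symm L with hp
  have hL : ∀ w, L w = inner ℝ p w := fun w => by simp [hp]
  have hn : ‖L‖ = ‖p‖ := by simp [hp]
  set b := inner ℝ p x with hb
  have h1 : L (v - (inner ℝ x v + height x * k) • x) =
      inner ℝ (p - b • x) v - b * height x * k := by
    rw [hL, inner_sub_right, inner_sub_left, inner_smul_right, inner_smul_left, ← hb]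
    simp
    ring
  have h2 : ‖p - b • x‖ ^ 2 = ‖p‖ ^ 2 - 2 * b ^ 2 + b ^ 2 * ‖x‖ ^ 2 := by
    rw [norm_sub_sq_real, inner_smul_right, norm_smul, ← hb, mul_pow, Real.norm_eq_abs, sq_abs]
    ring
  have h3 : ‖L‖ ^ 2 - (L x) ^ 2 = ‖p - b • x‖ ^ 2 + (b * height x) ^ 2 := by
    rw [hn, hL, ← hb, h2, mul_pow, hh]; ring
  rw [h1, h3]
  have h4 := abs_real_inner_le_norm (p - b • x) v
  set A := inner ℝ (p - b • x) v
  set w := ‖p - b • x‖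
  have hA : A ^ 2 ≤ w ^ 2 * ‖v‖ ^ 2 := by
    rw [← mul_pow, ← sq_abs A]; gcongr
  have hcross : -(2 * A * (b * height x * k)) ≤
      w ^ 2 * k ^ 2 + (b * height x) ^ 2 * ‖v‖ ^ 2 := by
    have hw : 0 ≤ w := norm_nonneg _
    calc -(2 * A * (b * height x * k)) ≤ |2 * A * (b * height x * k)| := neg_le_abs _
      _ = 2 * |A| * |b * height x * k| := by rw [abs_mul, abs_mul]; simp
      _ ≤ 2 * (w * ‖v‖) * |b * height x * k| := by gcongr
      _ = 2 * (w * |k|) * (|b * height x| * ‖v‖) := by rw [abs_mul]; ring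
      _ ≤ (w * |k|) ^ 2 + (|b * height x| * ‖v‖) ^ 2 := two_mul_le_add_sq _ _
      _ = _ := by rw [mul_pow, mul_pow, sq_abs, sq_abs]
  nlinarith

/-- The derivative of the radial projection along the direction `V`. -/
noncomputable def coneProjDeriv (X V : E d × ℝ) : E d :=
  (coneNorm X)⁻¹ • (V.1 - (inner ℝ (coneProj X) V.1 + X.2 / coneNorm X * V.2) • coneProj X)

lemma hasDerivAt_coneProj {X V : E d × ℝ} {τ : ℝ} (h : 0 < (X + τ • V).2) :
    HasDerivAt (fun t : ℝ => coneProj (X + t • V)) (coneProjDeriv (X + τ • V) V) τ := by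
  have hN := coneNorm_pos h
  have h1 : HasDerivAt (fun t : ℝ => (X + t • V).1) V.1 τ := by
    simpa using ((hasDerivAt_id τ).smul_const V.1).const_add X.1
  have h2 : HasDerivAt (fun t : ℝ => (X + t • V).2) V.2 τ := by
    simpa using ((hasDerivAt_id τ).mul_const V.2).const_add X.2
  have h3 := (h1.norm_sq.add (h2.pow 2)).sqrt (by
    exact (by positivity : 0 < ‖(X + τ • V).1‖ ^ 2 + (X + τ • V).2 ^ 2).ne')
  have h4 := (h3.inv (by exact hN.ne')).smul h1
  refine h4.congr_deriv ?_
  change (coneNorm (X + τ • V))⁻¹ • V.1 + _ • (X + τ • V).1 = _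
  change _ + (-(_ / (2 * coneNorm (X + τ • V))) / coneNorm (X + τ • V) ^ 2) • (X + τ • V).1 = _
  unfold coneProjDeriv
  rw [smul_sub, sub_eq_add_neg, smul_smul]
  congr 1
  rw [← neg_smul]
  unfold coneProj
  rw [smul_smul, inner_smul_left]
  congr 1
  simp
  field_simp

lemma sq_fderiv_coneProjDeriv_le (u : E d → ℝ) {X : E d × ℝ} (h : 0 < X.2) (V : E d × ℝ) :
    (fderiv ℝ u (coneProj X) (coneProjDeriv X V)) ^ 2 ≤
      (‖V.1‖ ^ 2 + V.2 ^ 2) * (gradSq u (coneProj X) / coneNorm X ^ 2) := by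
  have hN := coneNorm_pos h
  have := sq_apply_le_gradSq (fderiv ℝ u (coneProj X)) (coneProj_mem h) V.1 V.2
  rw [height_coneProj h] at this
  rw [coneProjDeriv, map_smul, smul_eq_mul, mul_pow, inv_pow, inv_mul_eq_div, ← mul_div_assoc,
    mul_comm (‖V.1‖ ^ 2 + V.2 ^ 2)]
  gcongr
  exact this

/-- This is Cauchy–Schwarz, obtained from the nonnegativity of the variance of D on [0, T]. -/
lemma sq_intervalIntegral_le {D : ℝ → ℝ} {T : ℝ} (hT : 0 < T) (hD : ContinuousOn D (Set.Icc 0 T)) :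
    (∫ t in (0 : ℝ)..T, D t) ^ 2 ≤ T * ∫ t in (0 : ℝ)..T, D t ^ 2 := by
  have hD' : ContinuousOn D (Set.uIcc 0 T) := by rwa [Set.uIcc_of_le hT.le]
  set I := ∫ t in (0 : ℝ)..T, D t with hI
  have h0 : 0 ≤ ∫ t in (0 : ℝ)..T, (D t - I / T) ^ 2 :=
    intervalIntegral.integral_nonneg hT.le fun _ _ => sq_nonneg _
  have h1 : ∫ t in (0 : ℝ)..T, (D t - I / T) ^ 2 =
      (∫ t in (0 : ℝ)..T, D t ^ 2) - 2 * (I / T) * I + T * (I / T) ^ 2 := by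
    have e : ∀ t, (D t - I / T) ^ 2 = D t ^ 2 - 2 * (I / T) * D t + (I / T) ^ 2 := fun t => by ring
    simp only [e]
    rw [intervalIntegral.integral_add, intervalIntegral.integral_sub,
      intervalIntegral.integral_const_mul, intervalIntegral.integral_const, ← hI]
    · simp
    · exact (hD'.pow 2).intervalIntegrable
    · exact (hD'.const_mul _).intervalIntegrable
    · exact ((hD'.pow 2).sub (hD'.const_mul _)).intervalIntegrable
    · simp
  rw [h1] at h0
  have e2 : (∫ t in (0 : ℝ)..T, D t ^ 2) - 2 * (I / T) * I + T * (I / T) ^ 2 =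
      (∫ t in (0 : ℝ)..T, D t ^ 2) - I ^ 2 / T := by
    field_simp; ring
  rw [e2, sub_nonneg, div_le_iff₀ hT] at h0
  linarith

/-- The oscillation along a segment of the function `u`, extended to the upper half space by
homogeneity of degree zero, is bounded by the energy density along the segment. -/
theorem sq_coneProj_sub_le {u : E d → ℝ} (hu : ContDiffOn ℝ 1 u (Metric.ball 0 1))
    {X V : E d × ℝ} {T : ℝ} (hT : 0 < T) (hX : 0 < X.2) (hXT : 0 < (X + T • V).2) :
    ENNReal.ofReal ((u (coneProj X) - u (coneProj (X + T • V))) ^ 2) ≤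
      ENNReal.ofReal (T * (‖V.1‖ ^ 2 + V.2 ^ 2)) * ∫⁻ τ in Set.Ioc 0 T,
        ENNReal.ofReal (gradSq u (coneProj (X + τ • V)) / coneNorm (X + τ • V) ^ 2) := by
  have hpos : ∀ τ ∈ Set.Icc 0 T, 0 < (X + τ • V).2 := fun τ hτ => by
    have e : (X + τ • V).2 = (1 - τ / T) * X.2 + τ / T * (X + T • V).2 := by
      simp; field_simp; ring
    rw [e]
    have h1 : 0 ≤ τ / T := div_nonneg hτ.1 hT.le
    have h2 : τ / T ≤ 1 := (div_le_one hT).2 hτ.2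
    rcases h1.eq_or_lt with h | h
    · rw [← h]; simpa using hX
    · have := mul_pos h hXT
      have : 0 ≤ (1 - τ / T) * X.2 := mul_nonneg (by linarith) hX.le
      linarith
  set D : ℝ → ℝ := fun τ => fderiv ℝ u (coneProj (X + τ • V)) (coneProjDeriv (X + τ • V) V)
    with hDdef
  have hder : ∀ τ ∈ Set.Icc 0 T, HasDerivAt (fun t => u (coneProj (X + t • V))) (D τ) τ := by
    intro τ hτ
    have hm := coneProj_mem (hpos τ hτ)
    have hd := ((hu.contDiffAt (Metric.isOpen_ball.mem_nhds hm)).differentiableAt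
      (by norm_num)).hasFDerivAt
    exact hd.comp_hasDerivAt τ (hasDerivAt_coneProj (hpos τ hτ))
  have hcN : ContinuousOn (fun τ : ℝ => (coneNorm (X + τ • V))⁻¹) (Set.Icc 0 T) :=
    ContinuousOn.inv₀ (by fun_prop) fun τ hτ => (coneNorm_pos (hpos τ hτ)).ne'
  have hcP : ContinuousOn (fun τ : ℝ => coneProj (X + τ • V)) (Set.Icc 0 T) := by
    unfold coneProj; fun_prop
  have hcD : ContinuousOn D (Set.Icc 0 T) := by
    have h1 : ContinuousOn (fun τ : ℝ => fderiv ℝ u (coneProj (X + τ • V))) (Set.Icc 0 T) :=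
      (hu.continuousOn_fderiv_of_isOpen Metric.isOpen_ball le_rfl).comp hcP
        fun τ hτ => coneProj_mem (hpos τ hτ)
    have h2 : ContinuousOn (fun τ : ℝ => coneProjDeriv (X + τ • V) V) (Set.Icc 0 T) := by
      unfold coneProjDeriv
      simp only [div_eq_mul_inv]
      fun_prop
    exact h1.clm_apply h2
  have hcD' : ContinuousOn D (Set.uIcc 0 T) := by rwa [Set.uIcc_of_le hT.le]
  have hftc : ∫ t in (0 : ℝ)..T, D t = u (coneProj (X + T • V)) - u (coneProj X) := by
    rw [intervalIntegral.integral_eq_sub_of_hasDerivAt (f := fun t => u (coneProj (X + t • V)))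
      (by rwa [Set.uIcc_of_le hT.le]) hcD'.intervalIntegrable]
    simp
  have hcs := sq_intervalIntegral_le hT hcD
  rw [hftc] at hcs
  have hI : ENNReal.ofReal (∫ t in (0 : ℝ)..T, D t ^ 2) =
      ∫⁻ t in Set.Ioc 0 T, ENNReal.ofReal (D t ^ 2) := by
    rw [intervalIntegral.integral_of_le hT.le, ofReal_integral_eq_lintegral_ofReal]
    · exact (intervalIntegrable_iff_integrableOn_Ioc_of_le hT.le).1 (hcD'.pow 2).intervalIntegrable
    · exact Eventually.of_forall fun _ => sq_nonneg _
  calc ENNReal.ofReal ((u (coneProj X) - u (coneProj (X + T • V))) ^ 2)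
      ≤ ENNReal.ofReal (T * ∫ t in (0 : ℝ)..T, D t ^ 2) :=
        ENNReal.ofReal_le_ofReal (by rw [sub_sq_comm]; exact hcs)
    _ = ENNReal.ofReal T * ∫⁻ t in Set.Ioc 0 T, ENNReal.ofReal (D t ^ 2) := by
        rw [ENNReal.ofReal_mul hT.le, hI]
    _ ≤ ENNReal.ofReal T * ∫⁻ t in Set.Ioc 0 T, ENNReal.ofReal (‖V.1‖ ^ 2 + V.2 ^ 2) *
          ENNReal.ofReal (gradSq u (coneProj (X + t • V)) / coneNorm (X + t • V) ^ 2) := by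
        gcongr ENNReal.ofReal T * ?_
        refine lintegral_mono_ae ?_
        filter_upwards [ae_restrict_mem measurableSet_Ioc] with t ht
        rw [← ENNReal.ofReal_mul (by positivity)]
        exact ENNReal.ofReal_le_ofReal
          (sq_fderiv_coneProjDeriv_le u (hpos t ⟨ht.1.le, ht.2⟩) V)
    _ = _ := by
        rw [lintegral_const_mul _ (by fun_prop), ENNReal.ofReal_mul hT.le, mul_assoc]

/-! ### Caps, the cones over them, and transfer of integrals between the two. -/

/-- The point of the closed upper hemisphere above `z`. -/
noncomputable def lift (z : E d) : E d × ℝ := (z, height z)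

/-- The Euclidean inner product of `X` with the point of the upper hemisphere above `z`. -/
noncomputable def coneInner (z : E d) (X : E d × ℝ) : ℝ := inner ℝ z X.1 + height z * X.2

/-- The part in the open unit ball of a geodesic ball around `z`, `c` being the cosine of the
radius. -/
def cap (z : E d) (c : ℝ) : Set (E d) :=
  {x | x ∈ Metric.ball 0 1 ∧ c < inner ℝ z x + height z * height x}

lemma coneNorm_eq_norm (X : E d × ℝ) : coneNorm X = ‖WithLp.toLp 2 X‖ := by
  rw [WithLp.prod_norm_eq_of_L2]
  simp [coneNorm]

lemma coneNorm_add_le (X Y : E d × ℝ) : coneNorm (X + Y) ≤ coneNorm X + coneNorm Y := by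
  simpa only [coneNorm_eq_norm, WithLp.toLp_add] using norm_add_le _ _

lemma coneNorm_smul (t : ℝ) (X : E d × ℝ) : coneNorm (t • X) = |t| * coneNorm X := by
  simp only [coneNorm_eq_norm, WithLp.toLp_smul, norm_smul, Real.norm_eq_abs]

lemma coneNorm_sub_le (X Y : E d × ℝ) : coneNorm (X - Y) ≤ coneNorm X + coneNorm Y := by
  simpa only [coneNorm_eq_norm, WithLp.toLp_sub] using norm_sub_le _ _

lemma coneInner_add (z : E d) (X Y : E d × ℝ) :
    coneInner z (X + Y) = coneInner z X + coneInner z Y := by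
  simp [coneInner, inner_add_right]; ring

lemma coneInner_smul (z : E d) (t : ℝ) (X : E d × ℝ) :
    coneInner z (t • X) = t * coneInner z X := by
  simp [coneInner, inner_smul_right]; ring

@[fun_prop]
lemma continuous_coneInner (z : E d) : Continuous (coneInner z) := by
  unfold coneInner; fun_prop

@[fun_prop]
lemma measurable_coneInner (z : E d) : Measurable (coneInner z) :=
  (continuous_coneInner z).measurable

lemma measurableSet_cap (z : E d) (c : ℝ) : MeasurableSet (cap z c) :=
  (measurableSet_ball (x := (0 : E d)) (ε := 1)).inter
    (measurableSet_lt (f := fun _ => c) measurable_const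
      (by fun_prop : Measurable fun x : E d => inner ℝ z x + height z * height x))

lemma coneInner_lift {z : E d} (hz : z ∈ unitBall d) : coneInner z (lift z) = 1 := by
  have := height_sq hz
  simp only [coneInner, lift, real_inner_self_eq_norm_sq]
  linarith

lemma coneNorm_lift {z : E d} (hz : z ∈ unitBall d) : coneNorm (lift z) = 1 := by
  rw [coneNorm, lift, height_sq hz]; simp

lemma abs_coneInner_le {z : E d} (hz : z ∈ unitBall d) (X : E d × ℝ) :
    |coneInner z X| ≤ coneNorm X := by
  have h := abs_real_inner_le_norm (WithLp.toLp 2 (lift z)) (WithLp.toLp 2 X)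
  rw [← coneNorm_eq_norm, ← coneNorm_eq_norm, coneNorm_lift hz, one_mul] at h
  rw [WithLp.prod_inner_apply] at h
  simpa [coneInner, lift, mul_comm] using h

lemma coneNorm_sub_sq {z : E d} (hz : z ∈ unitBall d) (X : E d × ℝ) :
    coneNorm (X - coneInner z X • lift z) ^ 2 = coneNorm X ^ 2 - coneInner z X ^ 2 := by
  have h2 := height_sq hz
  rw [coneNorm_sq, coneNorm_sq]
  simp only [Prod.fst_sub, Prod.snd_sub, Prod.smul_fst, Prod.smul_snd, lift, smul_eq_mul]
  rw [norm_sub_sq_real, inner_smul_right, norm_smul, mul_pow, Real.norm_eq_abs, sq_abs,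
    real_inner_comm]
  have e : inner ℝ z X.1 = coneInner z X - height z * X.2 := by simp [coneInner]
  rw [e]
  linear_combination coneInner z X ^ 2 * h2

lemma coneInner_polar (z x : E d) (ρ : ℝ) :
    coneInner z (ρ • x, ρ * height x) = ρ * (inner ℝ z x + height z * height x) := by
  simp [coneInner, inner_smul_right]; ring

lemma ballCos_le_one {z x : E d} (hz : z ∈ unitBall d) (hx : x ∈ unitBall d) :
    |inner ℝ z x + height z * height x| ≤ 1 := by
  have := abs_coneInner_le hz (lift x)
  rwa [coneNorm_lift hx] at this

lemma lintegral_weight_ball (μ : ℝ) (φ : E d → ENNReal) :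
    ∫⁻ x, φ x ∂(weight d μ) = ∫⁻ x in Metric.ball 0 1, φ x ∂(weight d μ) := by
  have h1 : ∀ᵐ x ∂(weight d μ), x ∈ Metric.ball (0 : E d) 1 := by
    refine (withDensity_absolutelyContinuous _ _).ae_le ?_
    rw [← Measure.restrict_congr_set (ball_ae_eq_unitBall d)]
    exact ae_restrict_mem measurableSet_ball
  rw [Measure.restrict_eq_self_of_ae_mem h1]

/-- The mass of the ray through `x` in the set `S`. -/
noncomputable def rayMass (μ : ℝ) (S : Set (E d × ℝ)) (k : ℝ → ENNReal) (x : E d) : ENNReal :=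
  ∫⁻ ρ in Set.Ioi (0 : ℝ), S.indicator 1 (ρ • x, ρ * height x) *
    (k ρ * ENNReal.ofReal (ρ ^ (d + 2 * μ)))

/-- Along a ray φ ∘ `coneProj` is constant and `coneNorm` is the radial variable, so the set S
enters only through the weighted mass of each ray. Comparing a cone region with a cap thus reduces
to upper and lower bounds for `rayMass`. -/
lemma setLIntegral_halfMeasure_polar (μ : ℝ) {S : Set (E d × ℝ)} (hS : MeasurableSet S)
    {k : ℝ → ENNReal} (hk : Measurable k) {φ : E d → ENNReal} (hφ : Measurable φ) :
    ∫⁻ X in S, φ (coneProj X) * k (coneNorm X) ∂(halfMeasure d (2 * μ)) =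
      ∫⁻ x in Metric.ball 0 1, φ x * rayMass μ S k x ∂(weight d μ) := by
  rw [← lintegral_indicator hS, lintegral_halfMeasure_polar μ
    ((by fun_prop : Measurable fun X : E d × ℝ =>
      φ (coneProj X) * k (coneNorm X)).indicator hS), lintegral_weight_ball]
  refine setLIntegral_congr_fun measurableSet_ball fun x hx => ?_
  have hx' := Metric.ball_subset_closedBall hx
  unfold rayMass
  rw [← lintegral_const_mul]
  · refine setLIntegral_congr_fun measurableSet_Ioi fun ρ hρ => ?_
    have hρ' : 0 < ρ := hρ
    by_cases h : (ρ • x, ρ * height x) ∈ S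
    · simp only [Set.indicator_of_mem h, coneProj_polar hx' hρ', coneNorm_polar hx' hρ'.le,
        Pi.one_apply, one_mul, mul_assoc]
    · simp [Set.indicator_of_notMem h]
  · have : Measurable fun ρ : ℝ => S.indicator (1 : E d × ℝ → ENNReal) (ρ • x, ρ * height x) :=
      (measurable_one.indicator hS).comp (by fun_prop)
    fun_prop

lemma setLIntegral_halfMeasure_le (μ : ℝ) {S : Set (E d × ℝ)} (hS : MeasurableSet S)
    {k : ℝ → ENNReal} (hk : Measurable k) {φ : E d → ENNReal} (hφ : Measurable φ)
    {z : E d} {c : ℝ} {M : ENNReal}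
    (hSc : ∀ x ∈ Metric.ball (0 : E d) 1, ∀ ρ > 0, (ρ • x, ρ * height x) ∈ S → x ∈ cap z c)
    (hM : ∀ x ∈ cap z c, rayMass μ S k x ≤ M) :
    ∫⁻ X in S, φ (coneProj X) * k (coneNorm X) ∂(halfMeasure d (2 * μ)) ≤
      M * ∫⁻ x in cap z c, φ x ∂(weight d μ) := by
  rw [setLIntegral_halfMeasure_polar μ hS hk hφ, ← lintegral_const_mul _ hφ,
    ← lintegral_indicator (measurableSet_cap z c), ← lintegral_indicator measurableSet_ball]
  refine lintegral_mono fun x => ?_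
  by_cases hx : x ∈ cap z c
  · rw [Set.indicator_of_mem hx, Set.indicator_of_mem hx.1, mul_comm]
    gcongr
    exact hM x hx
  · rw [Set.indicator_of_notMem hx]
    refine Set.indicator_apply_le' (fun hxb => ?_) fun _ => le_rfl
    have : rayMass μ S k x = 0 := by
      unfold rayMass
      rw [setLIntegral_congr_fun measurableSet_Ioi (g := fun _ => 0)]
      · simp
      · intro ρ hρ
        simp [Set.indicator_of_notMem fun h => hx (hSc x hxb ρ hρ h)]
    simp [this]

lemma le_setLIntegral_halfMeasure (μ : ℝ) {S : Set (E d × ℝ)} (hS : MeasurableSet S)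
    {φ : E d → ENNReal} (hφ : Measurable φ) {z : E d} {c : ℝ} {m : ENNReal}
    (hm : ∀ x ∈ cap z c, m ≤ rayMass μ S 1 x) :
    m * ∫⁻ x in cap z c, φ x ∂(weight d μ) ≤
      ∫⁻ X in S, φ (coneProj X) ∂(halfMeasure d (2 * μ)) := by
  have := setLIntegral_halfMeasure_polar μ hS (k := 1) measurable_one hφ
  simp only [Pi.one_apply, mul_one] at this
  rw [this, ← lintegral_const_mul _ hφ, ← lintegral_indicator (measurableSet_cap z c),
    ← lintegral_indicator measurableSet_ball]
  refine lintegral_mono fun x => ?_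
  by_cases hx : x ∈ cap z c
  · rw [Set.indicator_of_mem hx, Set.indicator_of_mem hx.1, mul_comm]
    gcongr
    exact hm x hx
  · simp [Set.indicator_of_notMem hx]

lemma halfMeasure_lt_top {a : ℝ} (ha : -1 < a) {S : Set (E d × ℝ)} (hS : MeasurableSet S) {R : ℝ}
    (hR : 0 < R) (hSR : ∀ X ∈ S, coneNorm X ≤ R) : halfMeasure d a S < ⊤ := by
  have h1 : halfMeasure d a S = ∫⁻ X, S.indicator 1 X ∂(halfMeasure d a) := by
    rw [lintegral_indicator_one hS]
  rw [h1, lintegral_halfMeasure a (measurable_one.indicator hS)]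
  have hb : ∀ X : E d × ℝ, halfDensity a X.2 * S.indicator 1 X ≤
      (Metric.closedBall (0 : E d) R).indicator 1 X.1 *
        ((Set.Ioc 0 R).indicator (halfDensity a) X.2) := by
    intro X
    by_cases hX : X ∈ S
    · by_cases h2 : 0 < X.2
      · have hN := hSR X hX
        have hsq := coneNorm_sq X
        have hN0 := coneNorm_nonneg X
        have e1 : ‖X.1‖ ≤ R := (abs_le_of_sq_le_sq' (by nlinarith) hR.le).2
        have e2 : X.2 ≤ R := (abs_le_of_sq_le_sq' (by nlinarith [sq_nonneg ‖X.1‖]) hR.le).2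
        rw [Set.indicator_of_mem hX, Set.indicator_of_mem (by simpa using e1),
          Set.indicator_of_mem (by exact ⟨h2, e2⟩)]
        simp
      · simp [halfDensity, h2]
    · simp [hX]
  refine lt_of_le_of_lt (lintegral_mono hb) ?_
  have hm : Measurable ((Set.Ioc 0 R).indicator (halfDensity a)) :=
    (measurable_halfDensity a).indicator measurableSet_Ioc
  have hm2 : Measurable ((Metric.closedBall (0 : E d) R).indicator (1 : E d → ENNReal)) :=
    measurable_one.indicator Metric.isClosed_closedBall.measurableSet
  rw [Measure.volume_eq_prod, lintegral_prod_mul hm2.aemeasurable hm.aemeasurable,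
    lintegral_indicator_one Metric.isClosed_closedBall.measurableSet,
    lintegral_indicator measurableSet_Ioc]
  refine ENNReal.mul_lt_top (isCompact_closedBall _ _).measure_lt_top ?_
  have h4 : ∫⁻ τ in Set.Ioc 0 R, halfDensity a τ = ∫⁻ τ in Set.Ioc 0 R, ENNReal.ofReal (τ ^ a) :=
    setLIntegral_congr_fun measurableSet_Ioc fun τ hτ => by simp [halfDensity, hτ.1]
  have h5 : IntegrableOn (fun τ : ℝ => τ ^ a) (Set.Ioc 0 R) :=
    (intervalIntegrable_iff_integrableOn_Ioc_of_le hR.le).1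
      (intervalIntegral.intervalIntegrable_rpow' ha)
  rw [h4]
  exact h5.lintegral_lt_top

/-- Beyond ρ = 1 the radial factor ρ^(d+2μ) is at least 1, so the mass dominates the length of the
interval. -/
lemma le_rayMass {μ : ℝ} (h0 : 0 ≤ (d : ℝ) + 2 * μ) {S : Set (E d × ℝ)} {x : E d} {p q : ℝ}
    (hp : 1 ≤ p) (hS : ∀ ρ ∈ Set.Ioo p q, (ρ • x, ρ * height x) ∈ S) :
    ENNReal.ofReal (q - p) ≤ rayMass μ S 1 x := by
  calc ENNReal.ofReal (q - p) = ∫⁻ ρ in Set.Ioo p q, 1 := by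
        rw [setLIntegral_const, Real.volume_Ioo, one_mul]
    _ ≤ ∫⁻ ρ in Set.Ioo p q, S.indicator 1 (ρ • x, ρ * height x) *
          ((1 : ℝ → ENNReal) ρ * ENNReal.ofReal (ρ ^ (d + 2 * μ))) := by
        refine lintegral_mono_ae ?_
        filter_upwards [ae_restrict_mem measurableSet_Ioo] with ρ hρ
        rw [Set.indicator_of_mem (hS ρ hρ)]
        simp only [Pi.one_apply, one_mul]
        rw [ENNReal.one_le_ofReal]
        exact Real.one_le_rpow (hp.trans hρ.1.le) h0
    _ ≤ rayMass μ S 1 x := lintegral_mono_set fun ρ hρ => by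
        simp only [Set.mem_Ioi]; linarith [hρ.1]

lemma cap_neg_two {z : E d} (hz : z ∈ unitBall d) : cap z (-2) = Metric.ball 0 1 := by
  refine Set.Subset.antisymm (fun x hx => hx.1) fun x hx => ⟨hx, ?_⟩
  have := neg_le_of_abs_le (ballCos_le_one hz (Metric.ball_subset_closedBall hx))
  linarith

/-- The shell 1 < |X| < 2 has finite mass in the half space, and every ray meets it in mass at least
1. The value -2 stands for any cosine below -1; its cap is the whole open ball. -/
lemma weight_univ_lt_top (hd : 2 ≤ d) {μ : ℝ} (hμ : -1 / 2 < μ) : weight d μ Set.univ < ⊤ := by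
  have hd0 : (2 : ℝ) ≤ d := by exact_mod_cast hd
  set S : Set (E d × ℝ) := {X | 1 < coneNorm X ∧ coneNorm X < 2} with hSdef
  have hS : MeasurableSet S :=
    (measurableSet_lt measurable_const measurable_coneNorm).inter
      (measurableSet_lt measurable_coneNorm measurable_const)
  have hfin := halfMeasure_lt_top (d := d) (a := 2 * μ) (by linarith) hS two_pos fun X hX => hX.2.le
  have h := le_setLIntegral_halfMeasure (d := d) μ hS (φ := 1) measurable_one
    (z := 0) (c := -2) (m := ENNReal.ofReal (2 - 1))
    fun x hx => le_rayMass (by linarith) le_rfl fun ρ hρ => by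
      have := coneNorm_polar (Metric.ball_subset_closedBall hx.1) (by linarith [hρ.1] : 0 ≤ ρ)
      rw [hSdef, Set.mem_ofPred_eq, this]
      exact hρ
  rw [cap_neg_two (by simp [unitBall])] at h
  norm_num [← lintegral_weight_ball] at h
  have e : lintegral (weight d μ) 1 = weight d μ Set.univ := lintegral_one
  exact (e ▸ h).trans_lt hfin

/-! ### The Poincaré inequality on convex subsets of the half space. -/

/-- The energy density on the upper half space of the degree zero homogeneous extension of `u`. -/
noncomputable def coneEnergy (u : E d → ℝ) (X : E d × ℝ) : ENNReal :=
  ENNReal.ofReal (gradSq u (coneProj X) / coneNorm X ^ 2)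

@[fun_prop]
lemma measurable_coneEnergy (u : E d → ℝ) : Measurable (coneEnergy u) := by
  unfold coneEnergy; fun_prop

lemma coneEnergy_eq (u : E d → ℝ) (X : E d × ℝ) :
    coneEnergy u X = ENNReal.ofReal (gradSq u (coneProj X)) *
      (fun ρ : ℝ => ENNReal.ofReal ((ρ ^ 2)⁻¹)) (coneNorm X) := by
  rw [coneEnergy, div_eq_mul_inv, ENNReal.ofReal_mul' (by positivity)]

lemma ofReal_sub_sq_le (x y z : ℝ) : ENNReal.ofReal ((x - z) ^ 2) ≤
    2 * ENNReal.ofReal ((x - y) ^ 2) + 2 * ENNReal.ofReal ((y - z) ^ 2) := by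
  rw [← ENNReal.ofReal_ofNat, ← ENNReal.ofReal_mul (by norm_num),
    ← ENNReal.ofReal_mul (by norm_num), ← ENNReal.ofReal_add (by positivity) (by positivity)]
  refine ENNReal.ofReal_le_ofReal ?_
  nlinarith [sq_nonneg ((x - y) - (y - z))]

/-- A weighted Poincaré inequality on convex sets of the upper half space, for functions
homogeneous of degree zero. -/
theorem exists_poincare_convex {a : ℝ} (ha : -1 < a) {u : E d → ℝ}
    (hu : ContDiffOn ℝ 1 u (Metric.ball 0 1)) (hum : Measurable u) {K : Set (E d × ℝ)}
    (hKm : MeasurableSet K) (hKc : Convex ℝ K) (hK0 : ∀ X ∈ K, 0 < X.2)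
    (hKfin : halfMeasure d a K ≠ ⊤) {D : ℝ}
    (hD : ∀ X ∈ K, ∀ Y ∈ K, coneNorm (X - Y) ^ 2 ≤ D) :
    ∃ k : ℝ, ∫⁻ X in K, ENNReal.ofReal ((u (coneProj X) - k) ^ 2) ∂(halfMeasure d a) ≤
      ENNReal.ofReal (D * (2 ^ (d + 1 + a) * translateConst a)) *
        ∫⁻ X in K, coneEnergy u X ∂(halfMeasure d a) := by
  set ν := halfMeasure d a with hν
  have hC := translateConst_pos ha
  rcases eq_or_ne (ν K) 0 with h0 | h0
  · refine ⟨0, ?_⟩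
    rw [Measure.restrict_eq_zero.2 h0]
    simp
  obtain ⟨X₀, hX₀⟩ := nonempty_of_measure_ne_zero h0
  have hD0 : 0 ≤ D := (sq_nonneg _).trans (hD X₀ hX₀ X₀ hX₀)
  set g : E d × ℝ → ENNReal := K.indicator (coneEnergy u) with hg
  have hgm : Measurable g := (measurable_coneEnergy u).indicator hKm
  have hgi : ∫⁻ X, g X ∂ν = ∫⁻ X in K, coneEnergy u X ∂ν := lintegral_indicator hKm _
  set J : E d × ℝ → E d × ℝ → ENNReal := fun X Y =>
    ∫⁻ τ in Set.Ioc 0 (1 / 2 : ℝ), g (X + τ • (Y - X)) with hJ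
  have hJm : Measurable (Function.uncurry J) := by
    have : Measurable fun p : ((E d × ℝ) × (E d × ℝ)) × ℝ =>
      g (p.1.1 + p.2 • (p.1.2 - p.1.1)) := by fun_prop
    exact this.lintegral_prod_right'
  have hmid : ∀ X ∈ K, ∀ Y ∈ K, ∀ τ ∈ Set.Icc (0 : ℝ) 1, X + τ • (Y - X) ∈ K :=
    fun X hX Y hY τ hτ => hKc.add_smul_sub_mem hX hY hτ
  have hhalf : ∀ X ∈ K, ∀ Y ∈ K, ENNReal.ofReal ((u (coneProj X) -
      u (coneProj (X + (1 / 2 : ℝ) • (Y - X)))) ^ 2) ≤ ENNReal.ofReal (1 / 2 * D) * J X Y := by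
    intro X hX Y hY
    refine (sq_coneProj_sub_le hu (by norm_num) (hK0 X hX)
      (hK0 _ (hmid X hX Y hY _ (by norm_num)))).trans ?_
    gcongr ENNReal.ofReal (1 / 2 * ?_) * ?_
    · rw [← coneNorm_sq]
      exact hD Y hY X hX
    · refine lintegral_mono_ae ?_
      filter_upwards [ae_restrict_mem measurableSet_Ioc] with τ hτ
      rw [hg, Set.indicator_of_mem (hmid X hX Y hY τ ⟨hτ.1.le, by linarith [hτ.2]⟩)]
      rfl
  have hpair : ∀ X ∈ K, ∀ Y ∈ K, ENNReal.ofReal ((u (coneProj X) - u (coneProj Y)) ^ 2) ≤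
      ENNReal.ofReal D * (J X Y + J Y X) := by
    intro X hX Y hY
    refine (ofReal_sub_sq_le _ (u (coneProj (X + (1 / 2 : ℝ) • (Y - X)))) _).trans ?_
    -- The two half-segments share their midpoint, so each half is charged to its own endpoint. In
    -- the double integral, `J X Y` is integrated first in X and `J Y X` first in Y.
    have e : X + (1 / 2 : ℝ) • (Y - X) = Y + (1 / 2 : ℝ) • (X - Y) := by module
    have h1 := hhalf X hX Y hY
    have h2 := hhalf Y hY X hX
    rw [← e, sub_sq_comm] at h2
    have e2 : ENNReal.ofReal D = 2 * ENNReal.ofReal (1 / 2 * D) := by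
      rw [← ENNReal.ofReal_ofNat, ← ENNReal.ofReal_mul (by norm_num)]
      congr 1; ring
    rw [e2, mul_assoc, mul_add, mul_add]
    gcongr
  set M : ENNReal := ENNReal.ofReal (2 ^ (d + 1 + a) * (translateConst a * (1 / 2))) *
    ∫⁻ X in K, coneEnergy u X ∂ν with hM
  have hseg : ∀ Y ∈ K, ∫⁻ X in K, J X Y ∂ν ≤ M := fun Y hY => by
    refine (setLIntegral_le_lintegral _ _).trans ?_
    rw [hM, ← hgi]
    exact lintegral_halfMeasure_segment ha (hK0 Y hY).le hgm
  have hJ1 : ∫⁻ Y in K, (∫⁻ X in K, J X Y ∂ν) ∂ν ≤ M * ν K := by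
    rw [← setLIntegral_const]
    exact setLIntegral_mono measurable_const hseg
  have hJ2 : ∫⁻ Y in K, (∫⁻ X in K, J Y X ∂ν) ∂ν ≤ M * ν K := by
    rw [lintegral_lintegral_swap (by exact hJm.aemeasurable)]
    exact hJ1
  have hA : ∫⁻ Y in K, (∫⁻ X in K, ENNReal.ofReal ((u (coneProj X) - u (coneProj Y)) ^ 2) ∂ν) ∂ν ≤
      ENNReal.ofReal D * (M * ν K + M * ν K) := by
    calc _ ≤ ∫⁻ Y in K, (∫⁻ X in K, ENNReal.ofReal D * (J X Y + J Y X) ∂ν) ∂ν :=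
          setLIntegral_mono' hKm fun Y hY => setLIntegral_mono' hKm fun X hX => hpair X hX Y hY
      _ = ENNReal.ofReal D * (∫⁻ Y in K, (∫⁻ X in K, J X Y ∂ν) ∂ν +
            ∫⁻ Y in K, (∫⁻ X in K, J Y X ∂ν) ∂ν) := by
          have m1 : Measurable fun p : (E d × ℝ) × (E d × ℝ) => J p.2 p.1 :=
            hJm.comp measurable_swap
          have m2 : ∀ Y, Measurable fun X => J X Y := fun Y => hJm.of_uncurry_right
          rw [← lintegral_add_left (by exact m1.lintegral_prod_right'), ← lintegral_const_mul']
          · refine lintegral_congr fun Y => ?_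
            rw [lintegral_const_mul' _ _ ENNReal.ofReal_ne_top, lintegral_add_left (m2 Y)]
          · exact ENNReal.ofReal_ne_top
      _ ≤ _ := by gcongr
  have hAm : Measurable fun Y => ∫⁻ X in K,
      ENNReal.ofReal ((u (coneProj X) - u (coneProj Y)) ^ 2) ∂ν := by
    have : Measurable fun p : (E d × ℝ) × (E d × ℝ) =>
      ENNReal.ofReal ((u (coneProj p.2) - u (coneProj p.1)) ^ 2) := by fun_prop
    exact this.lintegral_prod_right'
  -- Some Y in K does no worse than the average over K, and the value of u there serves as the
  -- constant k.
  obtain ⟨Y, -, hY⟩ := exists_le_setLAverage h0 hKfin hAm.aemeasurable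
  refine ⟨u (coneProj Y), hY.trans ?_⟩
  rw [setLAverage_eq]
  refine ENNReal.div_le_of_le_mul (hA.trans_eq ?_)
  have e3 : ENNReal.ofReal (D * (2 ^ (d + 1 + a) * translateConst a)) = ENNReal.ofReal D * (2 *
      ENNReal.ofReal (2 ^ (d + 1 + a) * (translateConst a * (1 / 2)))) := by
    rw [← ENNReal.ofReal_ofNat, ← ENNReal.ofReal_mul (by norm_num), ← ENNReal.ofReal_mul hD0]
    congr 1; ring
  rw [e3, hM]
  ring

/-! ### Geodesic balls of small radius. -/

/-- The part of the cone over `cap z c` between two parallel hyperplanes. -/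
def slab (z : E d) (c r : ℝ) : Set (E d × ℝ) :=
  {X | 0 < X.2 ∧ c * coneNorm X < coneInner z X ∧ 1 < coneInner z X ∧ coneInner z X < 1 + r}

lemma measurableSet_slab (z : E d) (c r : ℝ) : MeasurableSet (slab z c r) := by
  have h1 : Measurable fun X : E d × ℝ => c * coneNorm X := by fun_prop
  exact measurableSet_halfSpace.inter ((measurableSet_lt h1 (measurable_coneInner z)).inter
    ((measurableSet_lt measurable_const (measurable_coneInner z)).inter
      (measurableSet_lt (measurable_coneInner z) measurable_const)))

/-- For c ≥ 0 the function c|X| - ⟨z,X⟩ is convex, so the cone is convex; the remaining conditions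
are linear. -/
lemma convex_slab (z : E d) {c : ℝ} (hc : 0 ≤ c) (r : ℝ) : Convex ℝ (slab z c r) := by
  rintro X ⟨hX1, hX2, hX3, hX4⟩ Y ⟨hY1, hY2, hY3, hY4⟩ s t hs ht hst
  have key : ∀ p q p' q' : ℝ, p < q → p' < q' → s * p + t * p' < s * q + t * q' := by
    intro p q p' q' h h'
    rcases hs.eq_or_lt with h0 | h0
    · rw [← h0] at hst ⊢
      have : t = 1 := by linarith
      rw [this]; linarith
    · have := mul_lt_mul_of_pos_left h h0
      have := mul_le_mul_of_nonneg_left h'.le ht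
      linarith
  have hI : coneInner z (s • X + t • Y) = s * coneInner z X + t * coneInner z Y := by
    rw [coneInner_add, coneInner_smul, coneInner_smul]
  refine ⟨?_, ?_, ?_, ?_⟩
  · simpa using key _ _ _ _ hX1 hY1
  · rw [hI]
    refine lt_of_le_of_lt ?_ (key _ _ _ _ hX2 hY2)
    have := coneNorm_add_le (s • X) (t • Y)
    rw [coneNorm_smul, coneNorm_smul, abs_of_nonneg hs, abs_of_nonneg ht] at this
    nlinarith
  · rw [hI]
    have := key _ _ _ _ hX3 hY3
    linarith
  · rw [hI]
    have h1 := key _ _ _ _ hX4 hY4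
    have h2 : s * (1 + r) + t * (1 + r) = 1 + r := by rw [← add_mul, hst, one_mul]
    linarith

lemma coneNorm_slab_le {z : E d} {c r : ℝ} (hc : 1 / 2 ≤ c) (hr2 : r ≤ 2) {X : E d × ℝ}
    (hX : X ∈ slab z c r) : coneNorm X ≤ 6 := by
  have := hX.2.1
  have := hX.2.2.2
  nlinarith [coneNorm_nonneg X]

/-- Split off the component along the point above z. The orthogonal part of X has square |X|² -
⟨z,X⟩² ≤ (1-c²)|X|² ≤ 36r², since |X| ≤ 6, and the components along that direction differ by at most
r. Altogether the distance is at most 6r + 6r + r = 13r. -/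
lemma coneNorm_slab_sub_le {z : E d} (hz : z ∈ unitBall d) {c r : ℝ} (hc : 1 / 2 ≤ c) (hr : 0 < r)
    (hr2 : r ≤ 2) (hcr : 1 - c ^ 2 ≤ r ^ 2) {X Y : E d × ℝ} (hX : X ∈ slab z c r)
    (hY : Y ∈ slab z c r) : coneNorm (X - Y) ^ 2 ≤ 169 * r ^ 2 := by
  have key : ∀ W ∈ slab z c r, coneNorm (W - coneInner z W • lift z) ≤ 6 * r := by
    intro W hW
    refine abs_le_of_sq_le_sq' ?_ (by positivity) |>.2
    rw [coneNorm_sub_sq hz]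
    obtain ⟨-, h1, h2, h3⟩ := hW
    have hN := coneNorm_nonneg W
    have hN6 : coneNorm W ≤ 6 := by nlinarith
    have h4 : (c * coneNorm W) ^ 2 ≤ coneInner z W ^ 2 := by gcongr
    have h5 : coneNorm W ^ 2 ≤ 6 ^ 2 := by gcongr
    have h6 : (1 - c ^ 2) * coneNorm W ^ 2 ≤ r ^ 2 * 6 ^ 2 := by gcongr
    nlinarith
  have e : X - Y = ((X - coneInner z X • lift z) - (Y - coneInner z Y • lift z)) +
      (coneInner z X - coneInner z Y) • lift z := by module
  have h7 := coneNorm_add_le ((X - coneInner z X • lift z) - (Y - coneInner z Y • lift z))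
    ((coneInner z X - coneInner z Y) • lift z)
  have h8 := coneNorm_sub_le (X - coneInner z X • lift z) (Y - coneInner z Y • lift z)
  rw [← e, coneNorm_smul, coneNorm_lift hz, mul_one] at h7
  have h9 : |coneInner z X - coneInner z Y| ≤ r := by
    rw [abs_le]
    constructor <;> linarith [hX.2.2.1, hX.2.2.2, hY.2.2.1, hY.2.2.2]
  have h10 : coneNorm (X - Y) ≤ 13 * r := by linarith [key X hX, key Y hY]
  calc coneNorm (X - Y) ^ 2 ≤ (13 * r) ^ 2 := by gcongr; exact coneNorm_nonneg _
    _ = _ := by ring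

lemma mem_slab_polar {z x : E d} (hx : x ∈ Metric.ball (0 : E d) 1) {c r ρ : ℝ} (hρ : 0 < ρ) :
    (ρ • x, ρ * height x) ∈ slab z c r ↔ x ∈ cap z c ∧
      1 < ρ * (inner ℝ z x + height z * height x) ∧
      ρ * (inner ℝ z x + height z * height x) < 1 + r := by
  have hh := height_pos hx
  simp only [slab, cap, Set.mem_ofPred_eq, coneInner_polar,
    coneNorm_polar (Metric.ball_subset_closedBall hx) hρ.le]
  rw [mul_comm c, mul_lt_mul_iff_right₀ hρ]
  simp only [hx, true_and, mul_pos hρ hh]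

/-- The Poincaré inequality on small geodesic balls. -/
theorem exists_poincare_small (hd : 2 ≤ d) {μ : ℝ} (hμ : -1 / 2 < μ) :
    ∃ C : ℝ, 0 < C ∧ ∀ u : E d → ℝ, ContDiffOn ℝ 1 u (Metric.ball 0 1) → Measurable u →
      ∀ z ∈ unitBall d, ∀ c r : ℝ, 1 / 2 ≤ c → 0 < r → r ≤ 2 → 1 - c ^ 2 ≤ r ^ 2 →
        ∃ k : ℝ, ∫⁻ x in cap z c, ENNReal.ofReal ((u x - k) ^ 2) ∂(weight d μ) ≤
          ENNReal.ofReal (C * r ^ 2) *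
            ∫⁻ x in cap z c, ENNReal.ofReal (gradSq u x) ∂(weight d μ) := by
  have hd0 : (2 : ℝ) ≤ d := by exact_mod_cast hd
  have ha : -1 < 2 * μ := by linarith
  have hC := translateConst_pos ha
  set C₁ : ℝ := 169 * (2 ^ ((d : ℝ) + 1 + 2 * μ) * translateConst (2 * μ)) with hC₁
  -- A ray at cosine t in (1/2, 1] meets the slab in length r/t, between r and 2r, and there 1 ≤ ρ ≤
  -- 6. The factor 2 bounds the length and the power of 6 bounds the radial weight.
  set C₂ : ℝ := 2 * 6 ^ ((d : ℝ) + 2 * μ) with hC₂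
  refine ⟨C₁ * C₂, by positivity, fun u hu hum z hz c r hc hr hr2 hcr => ?_⟩
  have hKm := measurableSet_slab z c r
  obtain ⟨k, hk⟩ := exists_poincare_convex ha hu hum hKm (convex_slab z (by linarith) r)
    (fun X hX => hX.1)
    (halfMeasure_lt_top ha hKm (R := 6) (by norm_num)
      fun X hX => coneNorm_slab_le hc hr2 hX).ne
    (fun X hX Y hY => coneNorm_slab_sub_le hz hc hr hr2 hcr hX hY)
  refine ⟨k, ?_⟩
  have hcos : ∀ x ∈ cap z c, 1 / 2 < inner ℝ z x + height z * height x ∧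
      inner ℝ z x + height z * height x ≤ 1 := fun x hx =>
    ⟨hc.trans_lt hx.2, (le_abs_self _).trans
      (ballCos_le_one hz (Metric.ball_subset_closedBall hx.1))⟩
  have hlow : ENNReal.ofReal r * ∫⁻ x in cap z c, ENNReal.ofReal ((u x - k) ^ 2) ∂(weight d μ) ≤
      ∫⁻ X in slab z c r, ENNReal.ofReal ((u (coneProj X) - k) ^ 2) ∂(halfMeasure d (2 * μ)) := by
    refine le_setLIntegral_halfMeasure μ hKm (φ := fun x => ENNReal.ofReal ((u x - k) ^ 2))
      (by fun_prop) fun x hx => ?_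
    obtain ⟨ht, ht1⟩ := hcos x hx
    set t := inner ℝ z x + height z * height x with htd
    have ht0 : 0 < t := by linarith
    refine le_trans ?_ (le_rayMass (p := 1 / t) (q := (1 + r) / t) (by linarith)
      ((one_le_div ht0).2 ht1) fun ρ hρ => ?_)
    · refine ENNReal.ofReal_le_ofReal ?_
      rw [← sub_div, le_div_iff₀ ht0]
      nlinarith
    · have h1 : 1 < ρ * t := (div_lt_iff₀ ht0).1 hρ.1
      have h2 : ρ * t < 1 + r := (lt_div_iff₀ ht0).1 hρ.2
      have hρ0 : 0 < ρ := (by positivity : 0 < 1 / t).trans hρ.1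
      exact (mem_slab_polar hx.1 hρ0).2 ⟨hx, h1, h2⟩
  have hup : ∫⁻ X in slab z c r, coneEnergy u X ∂(halfMeasure d (2 * μ)) ≤
      ENNReal.ofReal (r * C₂) * ∫⁻ x in cap z c, ENNReal.ofReal (gradSq u x) ∂(weight d μ) := by
    simp only [coneEnergy_eq]
    refine setLIntegral_halfMeasure_le μ hKm
      (k := fun ρ : ℝ => ENNReal.ofReal ((ρ ^ 2)⁻¹)) (by fun_prop)
      (φ := fun x => ENNReal.ofReal (gradSq u x)) (by fun_prop)
      (fun x hx ρ hρ h => ((mem_slab_polar hx hρ).1 h).1) fun x hx => ?_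
    obtain ⟨ht, ht1⟩ := hcos x hx
    set t := inner ℝ z x + height z * height x with htd
    have ht0 : 0 < t := by linarith
    calc rayMass μ (slab z c r) (fun ρ : ℝ => ENNReal.ofReal ((ρ ^ 2)⁻¹)) x
        ≤ ∫⁻ ρ in Set.Ioi (0 : ℝ), (Set.Ioo (1 / t) ((1 + r) / t)).indicator
            (fun _ => ENNReal.ofReal (6 ^ ((d : ℝ) + 2 * μ))) ρ := by
          refine setLIntegral_mono' measurableSet_Ioi fun ρ hρ => ?_
          have hρ0 : 0 < ρ := hρ
          by_cases hm : (ρ • x, ρ * height x) ∈ slab z c r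
          · obtain ⟨-, h1, h2⟩ := (mem_slab_polar hx.1 hρ0).1 hm
            rw [← htd] at h1 h2
            have hI : ρ ∈ Set.Ioo (1 / t) ((1 + r) / t) :=
              ⟨(div_lt_iff₀ ht0).2 h1, (lt_div_iff₀ ht0).2 h2⟩
            rw [Set.indicator_of_mem hm, Set.indicator_of_mem hI, Pi.one_apply, one_mul,
              ← ENNReal.ofReal_mul (by positivity)]
            refine ENNReal.ofReal_le_ofReal ?_
            have h3 : 1 ≤ ρ := by nlinarith
            have h4 : ρ ≤ 6 := by nlinarith
            calc (ρ ^ 2)⁻¹ * ρ ^ ((d : ℝ) + 2 * μ) ≤ 1 * ρ ^ ((d : ℝ) + 2 * μ) := by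
                  gcongr
                  exact inv_le_one_of_one_le₀ (one_le_pow₀ h3)
              _ ≤ 6 ^ ((d : ℝ) + 2 * μ) := by
                  rw [one_mul]
                  exact Real.rpow_le_rpow hρ0.le h4 (by linarith)
          · simp [Set.indicator_of_notMem hm]
      _ ≤ ∫⁻ ρ, (Set.Ioo (1 / t) ((1 + r) / t)).indicator
            (fun _ => ENNReal.ofReal (6 ^ ((d : ℝ) + 2 * μ))) ρ := setLIntegral_le_lintegral _ _
      _ = ENNReal.ofReal (6 ^ ((d : ℝ) + 2 * μ) * ((1 + r) / t - 1 / t)) := by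
          rw [lintegral_indicator measurableSet_Ioo, setLIntegral_const, Real.volume_Ioo,
            ENNReal.ofReal_mul (by positivity)]
      _ ≤ ENNReal.ofReal (r * C₂) := by
          refine ENNReal.ofReal_le_ofReal ?_
          have h5 : (1 + r) / t - 1 / t ≤ 2 * r := by
            rw [← sub_div, div_le_iff₀ ht0]
            nlinarith
          have h6 : (0 : ℝ) ≤ 6 ^ ((d : ℝ) + 2 * μ) := by positivity
          calc _ ≤ 6 ^ ((d : ℝ) + 2 * μ) * (2 * r) := by gcongr
            _ = _ := by rw [hC₂]; ring
  have hr0 : ENNReal.ofReal r ≠ 0 := by simpa using hr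
  -- The thickness r of the slab appears on both sides, in `hlow` and in `hup`, and cancels; the r²
  -- left over comes from the squared diameter.
  rw [← ENNReal.mul_le_mul_iff_right hr0 ENNReal.ofReal_ne_top]
  refine hlow.trans (hk.trans ?_)
  calc _ ≤ ENNReal.ofReal (169 * r ^ 2 * (2 ^ ((d : ℝ) + 1 + 2 * μ) * translateConst (2 * μ))) *
        (ENNReal.ofReal (r * C₂) *
          ∫⁻ x in cap z c, ENNReal.ofReal (gradSq u x) ∂(weight d μ)) := by gcongr
    _ = _ := by
      rw [← mul_assoc, ← mul_assoc (ENNReal.ofReal r), ← ENNReal.ofReal_mul (by positivity),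
        ← ENNReal.ofReal_mul hr.le]
      congr 2
      rw [hC₁]; ring

/-! ### Geodesic balls of large radius. -/

/-- The part of the cone over `cap z c` of norm less than `R`. -/
def sector (z : E d) (c R : ℝ) : Set (E d × ℝ) :=
  {X | 0 < X.2 ∧ c * coneNorm X < coneInner z X ∧ coneNorm X < R}

lemma measurableSet_sector (z : E d) (c R : ℝ) : MeasurableSet (sector z c R) := by
  have h1 : Measurable fun X : E d × ℝ => c * coneNorm X := by fun_prop
  exact measurableSet_halfSpace.inter ((measurableSet_lt h1 (measurable_coneInner z)).inter
    (measurableSet_lt measurable_coneNorm measurable_const))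

lemma mem_sector_polar {z x : E d} (hx : x ∈ Metric.ball (0 : E d) 1) {c R ρ : ℝ} (hρ : 0 < ρ) :
    (ρ • x, ρ * height x) ∈ sector z c R ↔ x ∈ cap z c ∧ ρ < R := by
  have hh := height_pos hx
  simp only [sector, cap, Set.mem_ofPred_eq, coneInner_polar,
    coneNorm_polar (Metric.ball_subset_closedBall hx) hρ.le]
  rw [mul_comm c, mul_lt_mul_iff_right₀ hρ]
  simp only [hx, true_and, mul_pos hρ hh]

lemma lintegral_rpow_Ioc {b R : ℝ} (hb : -1 < b) (hR : 0 < R) :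
    ∫⁻ ρ in Set.Ioc 0 R, ENNReal.ofReal (ρ ^ b) = ENNReal.ofReal (R ^ (b + 1) / (b + 1)) := by
  have h := integral_rpow (a := 0) (b := R) (r := b) (Or.inl hb)
  rw [Real.zero_rpow (by linarith), sub_zero] at h
  rw [← h, intervalIntegral.integral_of_le hR.le, ofReal_integral_eq_lintegral_ofReal]
  · exact (intervalIntegrable_iff_integrableOn_Ioc_of_le hR.le).1
      (intervalIntegral.intervalIntegrable_rpow' hb)
  · filter_upwards [ae_restrict_mem measurableSet_Ioc] with τ hτ
    exact Real.rpow_nonneg hτ.1.le _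

/-- Every ray over the cap contributes the integral of ρ^(d+2μ-p) over (0, R], and `hp` is its
convergence at the vertex. The case p = 2 serves the energy of the degree zero extension, p = 0 the
function itself. For p = 2, convergence follows from d ≥ 2 and 2μ > -1. -/
lemma setLIntegral_sector_le (μ : ℝ) {p : ℕ} (hp : -1 < (d : ℝ) + 2 * μ - p) {z : E d} {c R : ℝ}
    (hR : 0 < R) {φ : E d → ENNReal} (hφ : Measurable φ) :
    ∫⁻ X in sector z c R, φ (coneProj X) *
        (fun ρ : ℝ => ENNReal.ofReal ((ρ ^ p)⁻¹)) (coneNorm X) ∂(halfMeasure d (2 * μ)) ≤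
      ENNReal.ofReal (R ^ ((d : ℝ) + 2 * μ - p + 1) / ((d : ℝ) + 2 * μ - p + 1)) *
        ∫⁻ x in cap z c, φ x ∂(weight d μ) := by
  refine setLIntegral_halfMeasure_le μ (measurableSet_sector z c R)
    (k := fun ρ : ℝ => ENNReal.ofReal ((ρ ^ p)⁻¹)) (by fun_prop) hφ
    (fun x hx ρ hρ h => ((mem_sector_polar hx hρ).1 h).1) fun x hx => ?_
  rw [← lintegral_rpow_Ioc hp hR, rayMass, ← lintegral_indicator measurableSet_Ioi,
    ← lintegral_indicator measurableSet_Ioc]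
  refine lintegral_mono fun ρ => ?_
  refine Set.indicator_apply_le fun hρ => ?_
  have hρ0 : 0 < ρ := hρ
  by_cases hm : (ρ • x, ρ * height x) ∈ sector z c R
  · have hI : ρ ∈ Set.Ioc 0 R := ⟨hρ0, ((mem_sector_polar hx.1 hρ0).1 hm).2.le⟩
    rw [Set.indicator_of_mem hm, Set.indicator_of_mem hI,
      Pi.one_apply, one_mul, ← ENNReal.ofReal_mul (by positivity), Real.rpow_sub hρ0,
      Real.rpow_natCast, inv_mul_eq_div]
  · simp [Set.indicator_of_notMem hm]

/-- Moving by τ along the unit vector above z raises ⟨z,X⟩ by exactly τ and changes c|X| by at most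
|c|τ ≤ τ. No convexity is involved, so c may be negative. -/
lemma add_smul_lift_mem_sector {z : E d} (hz : z ∈ unitBall d) {c R : ℝ} (hc : |c| ≤ 1)
    {X : E d × ℝ} (hX : X ∈ sector z c R) {τ : ℝ} (hτ : 0 ≤ τ) :
    X + τ • lift z ∈ sector z c (R + τ) := by
  obtain ⟨h1, h2, h3⟩ := hX
  have h4 := coneNorm_add_le X (τ • lift z)
  have h5 := coneNorm_sub_le (X + τ • lift z) (τ • lift z)
  rw [add_sub_cancel_right] at h5
  rw [coneNorm_smul, coneNorm_lift hz, mul_one, abs_of_nonneg hτ] at h4 h5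
  refine ⟨?_, ?_, by linarith⟩
  · have : 0 ≤ τ * height z := mul_nonneg hτ (height_nonneg z)
    simpa [lift] using add_pos_of_pos_of_nonneg h1 this
  · rw [coneInner_add, coneInner_smul, coneInner_lift hz, mul_one]
    have h6 : c * (coneNorm (X + τ • lift z) - coneNorm X) ≤ τ := by
      calc _ ≤ |c * (coneNorm (X + τ • lift z) - coneNorm X)| := le_abs_self _
        _ = |c| * |coneNorm (X + τ • lift z) - coneNorm X| := abs_mul _ _
        _ ≤ 1 * τ := by
          gcongr
          rw [abs_le]
          constructor <;> linarith
        _ = τ := one_mul _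
    linarith

/-- The threshold 6 comes from (2+τ)/2 < τ - 2: the left side bounds half the new norm and the right
side bounds the new inner product from below. -/
lemma add_smul_lift_mem_sector_half {z : E d} (hz : z ∈ unitBall d) {X : E d × ℝ} (hX0 : 0 < X.2)
    (hX : coneNorm X < 2) {τ : ℝ} (hτ : 6 < τ) :
    X + τ • lift z ∈ sector z (1 / 2) (2 + τ) := by
  have h4 := coneNorm_add_le X (τ • lift z)
  rw [coneNorm_smul, coneNorm_lift hz, mul_one, abs_of_nonneg (by linarith)] at h4
  have h5 := neg_le_of_abs_le (abs_coneInner_le hz X)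
  refine ⟨?_, ?_, by linarith⟩
  · have : 0 ≤ τ * height z := mul_nonneg (by linarith) (height_nonneg z)
    simpa [lift] using add_pos_of_pos_of_nonneg hX0 this
  · rw [coneInner_add, coneInner_smul, coneInner_lift hz, mul_one]
    linarith

/-- The deviation from a constant on a large cap is controlled by the deviation on a small cap and
by the energy. -/
theorem lintegral_cap_le_of_cap_half (hd : 2 ≤ d) {μ : ℝ} (hμ : -1 / 2 < μ) :
    ∃ C : ℝ, 0 < C ∧ ∀ u : E d → ℝ, ContDiffOn ℝ 1 u (Metric.ball 0 1) → Measurable u →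
      ∀ z ∈ unitBall d, ∀ c : ℝ, |c| ≤ 1 → ∀ k : ℝ,
        ∫⁻ x in cap z c, ENNReal.ofReal ((u x - k) ^ 2) ∂(weight d μ) ≤
          ENNReal.ofReal C * (∫⁻ x in cap z c, ENNReal.ofReal (gradSq u x) ∂(weight d μ) +
            ∫⁻ x in cap z (1 / 2), ENNReal.ofReal ((u x - k) ^ 2) ∂(weight d μ)) := by
  have hd0 : (2 : ℝ) ≤ d := by exact_mod_cast hd
  have ha : -1 < 2 * μ := by linarith
  have hT := translateConst_pos ha
  -- Translations of length below 14 are used, applied to points of norm below 2; hence the sectors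
  -- of radius 16 below.
  set A : ℝ := translateConst (2 * μ) * 14 with hA
  set C₁ : ℝ := 16 ^ ((d : ℝ) + 2 * μ - (2 : ℕ) + 1) / ((d : ℝ) + 2 * μ - (2 : ℕ) + 1) with hC₁
  set C₂ : ℝ := 16 ^ ((d : ℝ) + 2 * μ - (0 : ℕ) + 1) / ((d : ℝ) + 2 * μ - (0 : ℕ) + 1) with hC₂
  have hC₁0 : 0 < C₁ := by
    have : 0 < (d : ℝ) + 2 * μ - (2 : ℕ) + 1 := by push_cast; linarith
    positivity
  have hC₂0 : 0 < C₂ := by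
    have : 0 < (d : ℝ) + 2 * μ - (0 : ℕ) + 1 := by push_cast; linarith
    positivity
  refine ⟨28 * (A * C₁) + 2 * (A * C₂), by positivity, fun u hu hum z hz c hc k => ?_⟩
  set ν := halfMeasure d (2 * μ) with hν
  -- Rays over the cap cross this shell with mass at least 1, so the integral over the cap is at
  -- most the integral over K.
  set K : Set (E d × ℝ) := sector z c 2 ∩ {X | 1 < coneNorm X} with hK
  have hKm : MeasurableSet K := (measurableSet_sector z c 2).inter
    (measurableSet_lt measurable_const measurable_coneNorm)
  set G : ENNReal := ∫⁻ x in cap z c, ENNReal.ofReal (gradSq u x) ∂(weight d μ) with hG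
  set H : ENNReal := ∫⁻ x in cap z (1 / 2), ENNReal.ofReal ((u x - k) ^ 2) ∂(weight d μ) with hH
  set g : E d × ℝ → ENNReal := (sector z c 16).indicator (coneEnergy u) with hg
  have hgm : Measurable g := (measurable_coneEnergy u).indicator (measurableSet_sector z c 16)
  have hgi : ∫⁻ X, g X ∂ν ≤ ENNReal.ofReal C₁ * G := by
    rw [hg, lintegral_indicator (measurableSet_sector z c 16)]
    simp only [coneEnergy_eq]
    exact setLIntegral_sector_le μ (p := 2) (by push_cast; linarith) (by norm_num)
      (φ := fun x => ENNReal.ofReal (gradSq u x)) (by fun_prop)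
  set f : E d × ℝ → ENNReal := (sector z (1 / 2) 16).indicator
    (fun X => ENNReal.ofReal ((u (coneProj X) - k) ^ 2)) with hf
  have hfm : Measurable f :=
    (by fun_prop : Measurable fun X : E d × ℝ =>
      ENNReal.ofReal ((u (coneProj X) - k) ^ 2)).indicator (measurableSet_sector z (1 / 2) 16)
  have hfi : ∫⁻ X, f X ∂ν ≤ ENNReal.ofReal C₂ * H := by
    rw [hf, lintegral_indicator (measurableSet_sector z _ 16)]
    have := setLIntegral_sector_le μ (p := 0) (by push_cast; linarith) (z := z) (c := 1 / 2)
      (by norm_num : (0 : ℝ) < 16) (φ := fun x => ENNReal.ofReal ((u x - k) ^ 2)) (by fun_prop)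
    simp only [pow_zero, inv_one, ENNReal.ofReal_one, mul_one] at this
    exact this
  have hV : 0 ≤ (lift z).2 := height_nonneg z
  have hpt : ∀ X ∈ K, ENNReal.ofReal ((u (coneProj X) - k) ^ 2) ≤
      28 * (∫⁻ τ in Set.Ioc (0 : ℝ) 14, g (X + τ • lift z)) +
        2 * ∫⁻ τ in Set.Ioc (0 : ℝ) 14, f (X + τ • lift z) := by
    intro X hX
    set J : ENNReal := ∫⁻ τ in Set.Ioc (0 : ℝ) 14, g (X + τ • lift z) with hJ
    have h1 : ∀ τ ∈ Set.Ioo (6 : ℝ) 14, ENNReal.ofReal ((u (coneProj X) - k) ^ 2) ≤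
        28 * J + 2 * f (X + τ • lift z) := by
      intro τ hτ
      have hτ0 : 0 < τ := by linarith [hτ.1]
      have hmem := add_smul_lift_mem_sector hz hc hX.1 hτ0.le
      have hmem2 : X + τ • lift z ∈ sector z (1 / 2) 16 := by
        have := add_smul_lift_mem_sector_half hz hX.1.1 hX.1.2.2 hτ.1
        exact ⟨this.1, this.2.1, this.2.2.trans (by linarith [hτ.2])⟩
      refine (ofReal_sub_sq_le _ (u (coneProj (X + τ • lift z))) _).trans ?_
      rw [hf, Set.indicator_of_mem hmem2]
      refine add_le_add ?_ le_rfl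
      have h2 := sq_coneProj_sub_le hu hτ0 hX.1.1 hmem.1
      rw [← coneNorm_sq, coneNorm_lift hz] at h2
      have e : (28 : ENNReal) * J = 2 * (ENNReal.ofReal (14 * 1 ^ 2) * J) := by
        rw [← mul_assoc]
        congr 1
        norm_num
      rw [e]
      gcongr 2 * ?_
      refine h2.trans ?_
      gcongr ENNReal.ofReal (?_ * _) * ?_
      · exact hτ.2.le
      · refine le_trans (lintegral_mono_ae ?_) (lintegral_mono_set
          (Set.Ioc_subset_Ioc_right hτ.2.le))
        filter_upwards [ae_restrict_mem measurableSet_Ioc] with σ hσ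
        have h3 := add_smul_lift_mem_sector hz hc hX.1 hσ.1.le
        have h4 : X + σ • lift z ∈ sector z c 16 :=
          ⟨h3.1, h3.2.1, h3.2.2.trans_le (by linarith [hσ.2, hτ.2])⟩
        rw [hg, Set.indicator_of_mem h4]
        rfl
    have hfX : Measurable fun τ : ℝ => f (X + τ • lift z) := by fun_prop
    -- The bound `h1` is averaged over τ in an interval of length 1: the left side and J do not
    -- depend on τ, and the deviation at the translated point becomes an integral over translates,
    -- to which `lintegral_halfMeasure_translate` applies.
    calc ENNReal.ofReal ((u (coneProj X) - k) ^ 2)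
        = ∫⁻ τ in Set.Ioo (6 : ℝ) 7, ENNReal.ofReal ((u (coneProj X) - k) ^ 2) := by
          rw [setLIntegral_const, Real.volume_Ioo]; norm_num
      _ ≤ ∫⁻ τ in Set.Ioo (6 : ℝ) 7, (28 * J + 2 * f (X + τ • lift z)) :=
          setLIntegral_mono' measurableSet_Ioo fun τ hτ => h1 τ ⟨hτ.1, by linarith [hτ.2]⟩
      _ = 28 * J + 2 * ∫⁻ τ in Set.Ioo (6 : ℝ) 7, f (X + τ • lift z) := by
          rw [lintegral_add_left measurable_const, setLIntegral_const, Real.volume_Ioo,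
            lintegral_const_mul _ hfX]
          norm_num
      _ ≤ _ := by
          gcongr
          intro τ hτ
          exact ⟨by linarith [hτ.1], by linarith [hτ.2]⟩
  have hlow : ∫⁻ x in cap z c, ENNReal.ofReal ((u x - k) ^ 2) ∂(weight d μ) ≤
      ∫⁻ X in K, ENNReal.ofReal ((u (coneProj X) - k) ^ 2) ∂ν := by
    have := le_setLIntegral_halfMeasure μ hKm (φ := fun x => ENNReal.ofReal ((u x - k) ^ 2))
      (by fun_prop) (z := z) (c := c) (m := ENNReal.ofReal (2 - 1))
      fun x hx => le_rayMass (by linarith) le_rfl fun ρ hρ => by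
        have hρ0 : 0 < ρ := by linarith [hρ.1]
        refine ⟨(mem_sector_polar hx.1 hρ0).2 ⟨hx, hρ.2⟩, ?_⟩
        rw [Set.mem_ofPred_eq, coneNorm_polar (Metric.ball_subset_closedBall hx.1) hρ0.le]
        exact hρ.1
    norm_num at this
    exact this
  have hgt := lintegral_halfMeasure_translate ha hV (by norm_num : (0 : ℝ) < 14) hgm
  have hft := lintegral_halfMeasure_translate ha hV (by norm_num : (0 : ℝ) < 14) hfm
  have hg2 : Measurable fun X => ∫⁻ τ in Set.Ioc (0 : ℝ) 14, g (X + τ • lift z) := by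
    have : Measurable fun p : (E d × ℝ) × ℝ => g (p.1 + p.2 • lift z) := by fun_prop
    exact this.lintegral_prod_right'
  have hf2 : Measurable fun X => ∫⁻ τ in Set.Ioc (0 : ℝ) 14, f (X + τ • lift z) := by
    have : Measurable fun p : (E d × ℝ) × ℝ => f (p.1 + p.2 • lift z) := by fun_prop
    exact this.lintegral_prod_right'
  calc ∫⁻ x in cap z c, ENNReal.ofReal ((u x - k) ^ 2) ∂(weight d μ)
      ≤ ∫⁻ X in K, (28 * (∫⁻ τ in Set.Ioc (0 : ℝ) 14, g (X + τ • lift z)) +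
        2 * ∫⁻ τ in Set.Ioc (0 : ℝ) 14, f (X + τ • lift z)) ∂ν :=
        hlow.trans (setLIntegral_mono' hKm hpt)
    _ ≤ ∫⁻ X, (28 * (∫⁻ τ in Set.Ioc (0 : ℝ) 14, g (X + τ • lift z)) +
        2 * ∫⁻ τ in Set.Ioc (0 : ℝ) 14, f (X + τ • lift z)) ∂ν := setLIntegral_le_lintegral _ _
    _ = 28 * (∫⁻ X, (∫⁻ τ in Set.Ioc (0 : ℝ) 14, g (X + τ • lift z)) ∂ν) +
        2 * ∫⁻ X, (∫⁻ τ in Set.Ioc (0 : ℝ) 14, f (X + τ • lift z)) ∂ν := by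
        rw [lintegral_add_left (by fun_prop), lintegral_const_mul _ hg2, lintegral_const_mul _ hf2]
    _ ≤ 28 * (ENNReal.ofReal A * (ENNReal.ofReal C₁ * G)) +
        2 * (ENNReal.ofReal A * (ENNReal.ofReal C₂ * H)) := by
        gcongr
        · exact hgt.trans (by gcongr)
        · exact hft.trans (by gcongr)
    _ = ENNReal.ofReal (28 * (A * C₁)) * G + ENNReal.ofReal (2 * (A * C₂)) * H := by
        have hA0 : 0 < A := by positivity
        clear_value A
        rw [ENNReal.ofReal_mul (p := 28) (by norm_num), ENNReal.ofReal_mul (q := C₁) hA0.le,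
          ENNReal.ofReal_mul (p := 2) (by norm_num), ENNReal.ofReal_mul (q := C₂) hA0.le]
        simp only [ENNReal.ofReal_ofNat]
        ring
    _ ≤ _ := by
        rw [mul_add]
        gcongr
        · have : 0 < A * C₂ := by positivity
          linarith
        · have : 0 < A * C₁ := by positivity
          linarith

/-- The Poincaré inequality on geodesic balls, with an unspecified constant in place of the mean
value. -/
theorem exists_poincare_cap (hd : 2 ≤ d) {μ : ℝ} (hμ : -1 / 2 < μ) :
    ∃ C : ℝ, 0 < C ∧ ∀ u : E d → ℝ, ContDiffOn ℝ 1 u (Metric.ball 0 1) → Measurable u →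
      ∀ z ∈ unitBall d, ∀ r : ℝ, 0 < r →
        ∃ k : ℝ, ∫⁻ x in cap z (Real.cos (min r Real.pi)), ENNReal.ofReal ((u x - k) ^ 2)
            ∂(weight d μ) ≤ ENNReal.ofReal (C * r ^ 2) *
          ∫⁻ x in cap z (Real.cos (min r Real.pi)), ENNReal.ofReal (gradSq u x) ∂(weight d μ) := by
  obtain ⟨C, hC, hsmall⟩ := exists_poincare_small hd hμ
  obtain ⟨C', hC', hlarge⟩ := lintegral_cap_le_of_cap_half hd hμ
  refine ⟨C + C' * (1 + C), by positivity, fun u hu hum z hz r hr => ?_⟩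
  have hpi := Real.pi_gt_three
  have hpi4 := Real.pi_lt_four
  set c := Real.cos (min r Real.pi) with hc
  rcases le_or_gt (1 / 2) c with hc2 | hc2
  · have hsin : Real.sin (min r Real.pi) ^ 2 ≤ (min r Real.pi) ^ 2 := by
      have h0 : 0 ≤ min r Real.pi := le_min hr.le (by linarith)
      have h1 := Real.sin_le h0
      have h2 := Real.sin_nonneg_of_nonneg_of_le_pi h0 (min_le_right _ _)
      gcongr
    have hm0 : 0 < min r Real.pi := lt_min hr (by linarith)
    have hm3 : min r Real.pi ≤ 2 := by
      by_contra hcon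
      rw [not_le] at hcon
      have h2 := Real.cos_lt_cos_of_nonneg_of_le_pi (x := Real.pi / 3) (by positivity)
        (min_le_right r Real.pi) (by linarith)
      rw [Real.cos_pi_div_three] at h2
      linarith
    obtain ⟨k, hk⟩ := hsmall u hu hum z hz c (min r Real.pi) hc2 hm0 hm3 (by
      have := Real.sin_sq_add_cos_sq (min r Real.pi)
      rw [hc]; linarith)
    refine ⟨k, hk.trans ?_⟩
    gcongr
    · have : 0 ≤ C' * (1 + C) := by positivity
      linarith
    · exact min_le_left _ _
  -- The reference cap has cosine 1/2 with scale parameter 1, admissible since 1 - 1/4 ≤ 1. Its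
  -- constant k is then used on the large cap.
  · obtain ⟨k, hk⟩ := hsmall u hu hum z hz (1 / 2) 1 le_rfl one_pos (by norm_num) (by norm_num)
    refine ⟨k, (hlarge u hu hum z hz c (Real.abs_cos_le_one _) k).trans ?_⟩
    -- For r < 1 the bound cos r ≥ 1 - r²/2 > 1/2 would contradict c < 1/2.
    have hr1 : 1 ≤ r := by
      by_contra hcon
      rw [not_le] at hcon
      have h1 : min r Real.pi = r := min_eq_left (by linarith)
      have h2 := Real.one_sub_sq_div_two_le_cos (x := r)
      rw [hc, h1] at hc2
      nlinarith
    have hsub : cap z (1 / 2) ⊆ cap z c := fun x hx => ⟨hx.1, hc2.trans hx.2⟩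
    set G := ∫⁻ x in cap z c, ENNReal.ofReal (gradSq u x) ∂(weight d μ) with hG
    have hGle : ∫⁻ x in cap z (1 / 2), ENNReal.ofReal (gradSq u x) ∂(weight d μ) ≤ G :=
      lintegral_mono_set hsub
    calc _ ≤ ENNReal.ofReal C' * (G + ENNReal.ofReal (C * 1 ^ 2) * G) := by
          gcongr
          exact hk.trans (by gcongr)
      _ = ENNReal.ofReal (C' * (1 + C)) * G := by
          rw [ENNReal.ofReal_mul hC'.le, ENNReal.ofReal_add zero_le_one hC.le, ENNReal.ofReal_one]
          simp only [one_pow, mul_one]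
          ring
      _ ≤ _ := by
          gcongr ENNReal.ofReal ?_ * _
          have h1 : 1 ≤ r ^ 2 := one_le_pow₀ hr1
          have h2 : 0 ≤ C' * (1 + C) := by positivity
          nlinarith

/-! ### Classical and distributional derivatives on the punctured ball. -/

lemma isOpen_puncturedBall (d : ℕ) : IsOpen (puncturedBall d) :=
  Metric.isOpen_ball.sdiff isClosed_singleton

lemma norm_pos_of_mem {x : E d} (hx : x ∈ puncturedBall d) : 0 < ‖x‖ :=
  norm_pos_iff.2 fun h => hx.2 h

lemma ae_mem_puncturedBall (hd : 2 ≤ d) :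
    ∀ᵐ x ∂(volume.restrict (unitBall d)), x ∈ puncturedBall d := by
  have : Nonempty (Fin d) := ⟨⟨0, by omega⟩⟩
  rw [← Measure.restrict_congr_set (ball_ae_eq_unitBall d)]
  filter_upwards [ae_restrict_mem measurableSet_ball,
    ae_restrict_of_ae (Measure.ae_ne volume (0 : E d))] with x hx hx0
  exact ⟨hx, hx0⟩

lemma IsTest.eq_zero {φ : E d → ℝ} {x : E d} (hx : x ∉ tsupport φ) : φ x = 0 :=
  image_eq_zero_of_notMem_tsupport hx

lemma IsTest.fderiv_eq_zero {φ : E d → ℝ} {x : E d} (hx : x ∉ tsupport φ) : fderiv ℝ φ x = 0 :=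
  image_eq_zero_of_notMem_tsupport fun h => hx (tsupport_fderiv_subset ℝ h)

lemma contDiff_mul_test {φ : E d → ℝ} (hφ : IsTest φ) {k : E d → ℝ}
    (hk : ContDiffOn ℝ 1 k (puncturedBall d)) : ContDiff ℝ 1 fun x => k x * φ x := by
  rw [contDiff_iff_contDiffAt]
  intro x
  by_cases hx : x ∈ tsupport φ
  · exact (hk.contDiffAt ((isOpen_puncturedBall d).mem_nhds (hφ.2.2 hx))).mul hφ.1.contDiffAt
  · have h0 : (fun x => k x * φ x) =ᶠ[𝓝 x] fun _ => 0 := by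
      filter_upwards [(isClosed_tsupport φ).isOpen_compl.mem_nhds hx] with y hy
      rw [IsTest.eq_zero hy, mul_zero]
    exact contDiffAt_const.congr_of_eventuallyEq h0

lemma integral_fderiv_eq_zero {χ : E d → ℝ} (hχ : ContDiff ℝ 1 χ) (hc : HasCompactSupport χ)
    (v : E d) : ∫ x, fderiv ℝ χ x v = 0 := by
  have hd : Continuous fun x => fderiv ℝ χ x v :=
    (hχ.continuous_fderiv one_ne_zero).clm_apply continuous_const
  have hdc : HasCompactSupport fun x => fderiv ℝ χ x v :=
    (hc.fderiv ℝ).comp_left (g := fun L : E d →L[ℝ] ℝ => L v) rfl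
  have := integral_mul_fderiv_eq_neg_fderiv_mul_of_integrable (μ := (volume : Measure (E d)))
    (f := fun _ : E d => (1 : ℝ)) (g := χ) (v := v) (by simp)
    (by simpa using hd.integrable_of_hasCompactSupport hdc)
    (by simpa using hχ.continuous.integrable_of_hasCompactSupport hc)
    (fun x _ => by fun_prop) (fun x _ => hχ.differentiable one_ne_zero x)
  simpa using this

/-- The integrand is the divergence of the compactly supported field χ(x) x. -/
lemma integral_euler_eq_zero {χ : E d → ℝ} (hχ : ContDiff ℝ 1 χ) (hc : HasCompactSupport χ) :
    ∫ x, (fderiv ℝ χ x x + d * χ x) = 0 := by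
  have hi : ∀ i : Fin d, ContDiff ℝ 1 fun x : E d => χ x * x i := fun i => by fun_prop
  have hci : ∀ i : Fin d, HasCompactSupport fun x : E d => χ x * x i := fun i => hc.mul_right
  have hdi : ∀ i : Fin d, ∀ x, fderiv ℝ (fun x : E d => χ x * x i) x (EuclideanSpace.single i 1) =
      x i * fderiv ℝ χ x (EuclideanSpace.single i 1) + χ x := by
    intro i x
    have h1 := ((hχ.differentiable one_ne_zero) x).hasFDerivAt
    have h2 : HasFDerivAt (fun x : E d => x i) (EuclideanSpace.proj i : E d →L[ℝ] ℝ) x :=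
      (EuclideanSpace.proj i : E d →L[ℝ] ℝ).hasFDerivAt
    have h3 : fderiv ℝ (fun x : E d => χ x * x i) x = _ := (h1.mul h2).fderiv
    rw [h3]
    simp
    ring
  have hsum : ∀ x : E d, fderiv ℝ χ x x + d * χ x =
      ∑ i, fderiv ℝ (fun x : E d => χ x * x i) x (EuclideanSpace.single i 1) := by
    intro x
    simp only [hdi, Finset.sum_add_distrib]
    congr 1
    · refine (congrArg (fderiv ℝ χ x)
        ((EuclideanSpace.basisFun (Fin d) ℝ).sum_repr x).symm).trans ?_
      simp
    · simp
  simp only [hsum]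
  rw [integral_finsetSum]
  · exact Finset.sum_eq_zero fun i _ => integral_fderiv_eq_zero (hi i) (hci i) _
  · intro i _
    exact (((hi i).continuous_fderiv one_ne_zero).clm_apply
      continuous_const).integrable_of_hasCompactSupport (((hci i).fderiv ℝ).comp_left
        (g := fun L : E d →L[ℝ] ℝ => L (EuclideanSpace.single i 1)) rfl)

lemma MemL2Loc.integrableOn {F : Type*} [NormedAddCommGroup F] {f : E d → F} (hf : MemL2Loc f)
    {K : Set (E d)} (hK : IsCompact K) (hKU : K ⊆ puncturedBall d) : IntegrableOn f K := by
  have : IsFiniteMeasure (volume.restrict K) := ⟨by simpa using hK.measure_lt_top⟩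
  exact (hf K hK hKU).integrable (by norm_num)

lemma memL2Loc_of_continuousOn {F : Type*} [NormedAddCommGroup F]
    {f : E d → F} (hf : ContinuousOn f (puncturedBall d)) : MemL2Loc f := by
  intro K hK hKU
  have : IsFiniteMeasure (volume.restrict K) := ⟨by simpa using hK.measure_lt_top⟩
  obtain ⟨C, hC⟩ := hK.exists_bound_of_continuousOn (hf.mono hKU)
  exact MemLp.of_bound ((hf.mono hKU).aestronglyMeasurable_of_isCompact hK hK.measurableSet) C
    ((ae_restrict_iff' hK.measurableSet).2 (Eventually.of_forall hC))

lemma MemL2Loc.integrable_smul {F : Type*} [NormedAddCommGroup F] [NormedSpace ℝ F] {f : E d → ℝ}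
    (hf : MemL2Loc f) {φ : E d → ℝ} (hφ : IsTest φ) {g : E d → F}
    (hg : ContinuousOn g (puncturedBall d)) (h0 : ∀ x ∉ tsupport φ, g x = 0) :
    Integrable fun x => f x • g x := by
  have hK : IsCompact (tsupport φ) := hφ.2.1
  refine (integrableOn_iff_integrable_of_support_subset (s := tsupport φ) ?_).1
    ((hf.integrableOn hK hφ.2.2).smul_continuousOn (hg.mono hφ.2.2) hK)
  intro x hx
  by_contra h
  exact hx (by simp [h0 x h])

lemma MemL2Loc.integrable_test_smul {F : Type*} [NormedAddCommGroup F] [NormedSpace ℝ F]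
    {h : E d → F} (hh : MemL2Loc h) {φ : E d → ℝ} (hφ : IsTest φ) :
    Integrable fun x => φ x • h x := by
  have hK : IsCompact (tsupport φ) := hφ.2.1
  refine (integrableOn_iff_integrable_of_support_subset (s := tsupport φ) ?_).1
    ((hh.integrableOn hK hφ.2.2).continuousOn_smul hφ.1.continuous.continuousOn hK)
  intro x hx
  by_contra h
  exact hx (by simp [IsTest.eq_zero h])

lemma setIntegral_unitBall_eq {F : Type*} [NormedAddCommGroup F] [NormedSpace ℝ F] {φ : E d → ℝ}
    (hφ : IsTest φ) {g : E d → F} (h0 : ∀ x ∉ tsupport φ, g x = 0) :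
    ∫ x in unitBall d, g x = ∫ x, g x :=
  setIntegral_eq_integral_of_forall_compl_eq_zero fun x hx => h0 x fun h =>
    hx (Metric.ball_subset_closedBall (hφ.2.2 h).1)

lemma continuousOn_fderiv_punctured {u : E d → ℝ} (hu : ContDiffOn ℝ 1 u (puncturedBall d)) :
    ContinuousOn (fderiv ℝ u) (puncturedBall d) :=
  hu.continuousOn_fderiv_of_isOpen (isOpen_puncturedBall d) le_rfl

lemma continuousOn_classicalRadial {u : E d → ℝ} (hu : ContDiffOn ℝ 1 u (puncturedBall d)) :
    ContinuousOn (classicalRadial u) (puncturedBall d) :=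
  ((continuousOn_fderiv_punctured hu).clm_apply continuousOn_id).div (by fun_prop)
    fun _ hx => (norm_pos_of_mem hx).ne'

lemma continuousOn_classicalSpherical {u : E d → ℝ} (hu : ContDiffOn ℝ 1 u (puncturedBall d)) :
    ContinuousOn (classicalSpherical u) (puncturedBall d) := by
  have h1 := continuousOn_classicalRadial hu
  have h2 : ContinuousOn (gradient u) (puncturedBall d) :=
    (InnerProductSpace.toDual ℝ (E d)).symm.continuous.comp_continuousOn
      (continuousOn_fderiv_punctured hu)
  unfold classicalSpherical
  fun_prop

lemma inner_classicalSpherical (u : E d → ℝ) (x e : E d) :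
    inner ℝ e (classicalSpherical u x) =
      ‖x‖ * fderiv ℝ u x e - classicalRadial u x * inner ℝ e x := by
  rw [classicalSpherical, inner_sub_right, inner_smul_right, inner_smul_right, real_inner_comm,
    gradient, InnerProductSpace.toDual_symm_apply]

lemma classicalRadial_eq_zero {φ : E d → ℝ} {x : E d} (hx : x ∉ tsupport φ) :
    classicalRadial φ x = 0 := by
  simp [classicalRadial, IsTest.fderiv_eq_zero hx]

lemma classicalSpherical_eq_zero {φ : E d → ℝ} {x : E d} (hx : x ∉ tsupport φ) :
    classicalSpherical φ x = 0 := by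
  simp [classicalSpherical, classicalRadial_eq_zero hx, gradient, IsTest.fderiv_eq_zero hx]

lemma fderiv_mul_mul {u φ k : E d → ℝ} {x : E d} (hu : DifferentiableAt ℝ u x)
    (hφ : DifferentiableAt ℝ φ x) {k' : E d →L[ℝ] ℝ} (hk : HasFDerivAt k k' x) (v : E d) :
    fderiv ℝ (fun y => k y * u y * φ y) x v =
      k x * (u x * fderiv ℝ φ x v + φ x * fderiv ℝ u x v) + u x * φ x * k' v := by
  have := ((hk.mul hu.hasFDerivAt).mul hφ.hasFDerivAt).fderiv
  rw [show (fun y => k y * u y * φ y) = (k * u) * φ from rfl, this]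
  simp
  ring

lemma hasFDerivAt_norm_of_mem {x : E d} (hx : x ∈ puncturedBall d) :
    HasFDerivAt (fun y : E d => ‖y‖) (‖x‖⁻¹ • innerSL ℝ x) x := by
  have hn := norm_pos_of_mem hx
  have h1 := (hasStrictFDerivAt_norm_sq x).hasFDerivAt.sqrt (by positivity)
  refine (h1.congr_fderiv ?_).congr_of_eventuallyEq
    (Eventually.of_forall fun y => by simp [Real.sqrt_sq (norm_nonneg y)])
  ext v
  simp [Real.sqrt_sq hn.le]
  field_simp

lemma hasFDerivAt_inv_norm_of_mem {x : E d} (hx : x ∈ puncturedBall d) :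
    HasFDerivAt (fun y : E d => ‖y‖⁻¹) (-(‖x‖ ^ 3)⁻¹ • innerSL ℝ x) x := by
  have hn := norm_pos_of_mem hx
  refine ((hasDerivAt_inv hn.ne').comp_hasFDerivAt x (hasFDerivAt_norm_of_mem hx)).congr_fderiv ?_
  ext v
  simp
  field_simp

lemma contDiffOn_norm (d : ℕ) : ContDiffOn ℝ 1 (fun x : E d => ‖x‖) (puncturedBall d) :=
  contDiffOn_id.norm ℝ fun _ hx => norm_ne_zero_iff.1 (norm_pos_of_mem hx).ne'

lemma contDiffOn_inv_norm (d : ℕ) : ContDiffOn ℝ 1 (fun x : E d => ‖x‖⁻¹) (puncturedBall d) :=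
  (contDiffOn_norm d).inv fun _ hx => (norm_pos_of_mem hx).ne'

lemma hasCompactSupport_mul_test {φ : E d → ℝ} (hφ : IsTest φ) (k : E d → ℝ) :
    HasCompactSupport fun x => k x * φ x := hφ.2.1.mul_left

/-- The classical radial derivative of a `C¹` function is its distributional radial derivative. -/
theorem isRadialDeriv_classicalRadial {u : E d → ℝ} (hu : ContDiffOn ℝ 1 u (puncturedBall d)) :
    IsRadialDeriv u (classicalRadial u) := by
  refine ⟨memL2Loc_of_continuousOn hu.continuousOn,
    memL2Loc_of_continuousOn (continuousOn_classicalRadial hu), fun φ hφ => ?_⟩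
  have hL : Integrable fun x => classicalRadial u x * φ x := by
    simpa [mul_comm] using
      (memL2Loc_of_continuousOn (continuousOn_classicalRadial hu)).integrable_test_smul hφ
  have hR : Integrable fun x =>
      u x * (classicalRadial φ x + ((d : ℝ) - 1) / ‖x‖ * φ x) := by
    refine (memL2Loc_of_continuousOn hu.continuousOn).integrable_smul hφ ?_ fun x hx => by
      rw [classicalRadial_eq_zero hx, IsTest.eq_zero hx]; simp
    have := continuousOn_classicalRadial hφ.1.contDiffOn
    have h2 := (contDiffOn_inv_norm d).continuousOn
    have h3 := hφ.1.continuous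
    simp only [div_eq_mul_inv]
    fun_prop
  rw [setIntegral_unitBall_eq hφ fun x hx => by rw [IsTest.eq_zero hx, mul_zero],
    setIntegral_unitBall_eq hφ fun x hx => by
      rw [classicalRadial_eq_zero hx, IsTest.eq_zero hx]; simp]
  rw [eq_neg_iff_add_eq_zero, ← integral_add hL hR]
  -- With χ = uφ/|x|, the divergence of χ(x) x equals φ ∂ᵣu + u ∂ᵣφ + (d-1)uφ/|x|, which is exactly
  -- the integrand in question; the factor 1/|x| turns d into d-1.
  have hχ : ContDiff ℝ 1 fun x => ‖x‖⁻¹ * u x * φ x :=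
    contDiff_mul_test hφ ((contDiffOn_inv_norm d).mul hu)
  rw [← integral_euler_eq_zero hχ (hasCompactSupport_mul_test hφ fun x => ‖x‖⁻¹ * u x)]
  congr 1
  ext x
  by_cases hx : x ∈ tsupport φ
  · have hxU := hφ.2.2 hx
    have hn := norm_pos_of_mem hxU
    rw [fderiv_mul_mul ((hu.contDiffAt ((isOpen_puncturedBall d).mem_nhds hxU)).differentiableAt
      one_ne_zero) (hφ.1.differentiable one_ne_zero x) (hasFDerivAt_inv_norm_of_mem hxU)]
    simp only [classicalRadial, smul_apply, innerSL_apply_apply,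
      real_inner_self_eq_norm_sq, smul_eq_mul]
    field_simp
    ring
  · have hx' : x ∉ tsupport fun x => ‖x‖⁻¹ * u x * φ x :=
      fun h => hx (tsupport_mul_subset_right h)
    rw [IsTest.fderiv_eq_zero hx', IsTest.eq_zero hx, classicalRadial_eq_zero hx]
    simp

/-- The classical spherical gradient of a `C¹` function is its distributional spherical
gradient. -/
theorem isSphericalGrad_classicalSpherical {u : E d → ℝ}
    (hu : ContDiffOn ℝ 1 u (puncturedBall d)) : IsSphericalGrad u (classicalSpherical u) := by
  refine ⟨memL2Loc_of_continuousOn hu.continuousOn,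
    memL2Loc_of_continuousOn (continuousOn_classicalSpherical hu), fun φ hφ => ?_⟩
  have hL : Integrable fun x => φ x • classicalSpherical u x :=
    (memL2Loc_of_continuousOn (continuousOn_classicalSpherical hu)).integrable_test_smul hφ
  have hR : Integrable fun x =>
      u x • (classicalSpherical φ x - (((d : ℝ) - 1) * φ x / ‖x‖) • x) := by
    refine (memL2Loc_of_continuousOn hu.continuousOn).integrable_smul hφ ?_ fun x hx => by
      rw [classicalSpherical_eq_zero hx, IsTest.eq_zero hx]; simp
    have := continuousOn_classicalSpherical hφ.1.contDiffOn
    have h2 := (contDiffOn_inv_norm d).continuousOn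
    have h3 := hφ.1.continuous
    simp only [div_eq_mul_inv]
    fun_prop
  rw [setIntegral_unitBall_eq hφ fun x hx => by rw [IsTest.eq_zero hx, zero_smul],
    setIntegral_unitBall_eq hφ fun x hx => by
      rw [classicalSpherical_eq_zero hx, IsTest.eq_zero hx]; simp]
  rw [eq_neg_iff_add_eq_zero, ← integral_add hL hR]
  refine ext_inner_left ℝ fun e => ?_
  refine (integral_inner (hL.add hR) e).symm.trans ?_
  rw [inner_zero_right]
  have hk : ContDiffOn ℝ 1 (fun x : E d => ‖x‖⁻¹ * inner ℝ e x) (puncturedBall d) :=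
    (contDiffOn_inv_norm d).mul (innerSL ℝ e).contDiff.contDiffOn
  -- The e-component of the integrand is ∂_e(|x|uφ) minus the divergence of (⟨e,x⟩/|x|) uφ x. The
  -- first term yields ⟨e,x⟩uφ/|x|, the second d times that, which leaves the coefficient -(d-1).
  have hχ₁ : ContDiff ℝ 1 fun x => ‖x‖ * u x * φ x :=
    contDiff_mul_test hφ ((contDiffOn_norm d).mul hu)
  have hχ₂ : ContDiff ℝ 1 fun x => ‖x‖⁻¹ * inner ℝ e x * u x * φ x :=
    contDiff_mul_test hφ (hk.mul hu)
  have hc₁ := hasCompactSupport_mul_test hφ fun x => ‖x‖ * u x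
  have hc₂ := hasCompactSupport_mul_test hφ fun x => ‖x‖⁻¹ * inner ℝ e x * u x
  have h₁ := integral_fderiv_eq_zero hχ₁ hc₁ e
  have h₂ := integral_euler_eq_zero hχ₂ hc₂
  have hi₁ : Integrable fun x => fderiv ℝ (fun x => ‖x‖ * u x * φ x) x e :=
    ((hχ₁.continuous_fderiv one_ne_zero).clm_apply
      continuous_const).integrable_of_hasCompactSupport ((hc₁.fderiv ℝ).comp_left
        (g := fun L : E d →L[ℝ] ℝ => L e) rfl)
  have hi₂ : Integrable fun x => fderiv ℝ (fun x => ‖x‖⁻¹ * inner ℝ e x * u x * φ x) x x +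
      d * (‖x‖⁻¹ * inner ℝ e x * u x * φ x) := by
    refine Integrable.add ?_ ((hχ₂.continuous.integrable_of_hasCompactSupport hc₂).const_mul _)
    refine ((hχ₂.continuous_fderiv one_ne_zero).clm_apply
      continuous_id).integrable_of_hasCompactSupport ?_
    refine (hc₂.fderiv ℝ).mono fun x hx => ?_
    contrapose! hx
    simp only [Function.mem_support, not_not] at hx ⊢
    simp [hx]
  rw [show (0 : ℝ) = (∫ x, fderiv ℝ (fun x => ‖x‖ * u x * φ x) x e) -
    ∫ x, (fderiv ℝ (fun x => ‖x‖⁻¹ * inner ℝ e x * u x * φ x) x x +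
      d * (‖x‖⁻¹ * inner ℝ e x * u x * φ x)) by rw [h₁, h₂, sub_zero], ← integral_sub hi₁ hi₂]
  congr 1
  ext x
  by_cases hx : x ∈ tsupport φ
  · have hxU := hφ.2.2 hx
    have hn := norm_pos_of_mem hxU
    have hdu := (hu.contDiffAt ((isOpen_puncturedBall d).mem_nhds hxU)).differentiableAt
      one_ne_zero
    have hdφ := hφ.1.differentiable one_ne_zero x
    have hin : HasFDerivAt (fun y : E d => inner ℝ e y) (innerSL ℝ e) x :=
      (innerSL ℝ e).hasFDerivAt
    rw [fderiv_mul_mul hdu hdφ (hasFDerivAt_norm_of_mem hxU),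
      fderiv_mul_mul (k := fun y => ‖y‖⁻¹ * inner ℝ e y) hdu hdφ
        ((hasFDerivAt_inv_norm_of_mem hxU).mul hin)]
    simp only [Pi.add_apply, inner_add_right, inner_smul_right, inner_sub_right,
      inner_classicalSpherical]
    simp only [classicalRadial, smul_apply, add_apply,
      innerSL_apply_apply, real_inner_self_eq_norm_sq, smul_eq_mul, real_inner_comm e x]
    field_simp
    ring
  · have hx₁ : x ∉ tsupport fun x => ‖x‖ * u x * φ x := fun h => hx (tsupport_mul_subset_right h)
    have hx₂ : x ∉ tsupport fun x => ‖x‖⁻¹ * inner ℝ e x * u x * φ x :=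
      fun h => hx (tsupport_mul_subset_right h)
    rw [IsTest.fderiv_eq_zero hx₁, IsTest.fderiv_eq_zero hx₂, Pi.add_apply, IsTest.eq_zero hx,
      classicalSpherical_eq_zero hx]
    simp

lemma MemL2Loc.sub {F : Type*} [NormedAddCommGroup F] {f g : E d → F} (hf : MemL2Loc f)
    (hg : MemL2Loc g) : MemL2Loc (f - g) := fun K hK hKU => (hf K hK hKU).sub (hg K hK hKU)

/-- A locally square integrable function orthogonal to all test functions vanishes. -/
lemma ae_eq_of_forall_test (hd : 2 ≤ d) {F : Type*} [NormedAddCommGroup F] [NormedSpace ℝ F]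
    [CompleteSpace F] {g h : E d → F} (hg : MemL2Loc g) (hh : MemL2Loc h)
    (heq : ∀ φ : E d → ℝ, IsTest φ →
      ∫ x in unitBall d, φ x • g x = ∫ x in unitBall d, φ x • h x) :
    g =ᵐ[volume.restrict (unitBall d)] h := by
  have hloc : LocallyIntegrableOn (g - h) (puncturedBall d) := by
    rw [locallyIntegrableOn_iff (isOpen_puncturedBall d).isLocallyClosed]
    exact fun K hKU hK => (hg.sub hh).integrableOn hK hKU
  have := (isOpen_puncturedBall d).ae_eq_zero_of_integral_contDiff_smul_eq_zero hloc
    fun φ hφ hc hs => by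
      have ht : IsTest φ := ⟨hφ.of_le (by exact_mod_cast le_top), hc, hs⟩
      have h1 := heq φ ht
      rw [setIntegral_unitBall_eq ht fun x hx => by rw [IsTest.eq_zero hx, zero_smul],
        setIntegral_unitBall_eq ht fun x hx => by rw [IsTest.eq_zero hx, zero_smul]] at h1
      simp only [Pi.sub_apply, smul_sub]
      rw [integral_sub (hg.integrable_test_smul ht) (hh.integrable_test_smul ht), h1, sub_self]
  filter_upwards [ae_mem_puncturedBall hd, ae_restrict_of_ae this] with x hx hx2
  exact sub_eq_zero.1 (hx2 hx)

lemma continuousOn_radial_test {φ : E d → ℝ} (hφ : IsTest φ) :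
    ContinuousOn (fun x => classicalRadial φ x + ((d : ℝ) - 1) / ‖x‖ * φ x)
      (puncturedBall d) := by
  have := continuousOn_classicalRadial hφ.1.contDiffOn
  have h2 := (contDiffOn_inv_norm d).continuousOn
  have h3 := hφ.1.continuous
  simp only [div_eq_mul_inv]
  fun_prop

lemma continuousOn_spherical_test {φ : E d → ℝ} (hφ : IsTest φ) :
    ContinuousOn (fun x => classicalSpherical φ x - (((d : ℝ) - 1) * φ x / ‖x‖) • x)
      (puncturedBall d) := by
  have := continuousOn_classicalSpherical hφ.1.contDiffOn
  have h2 := (contDiffOn_inv_norm d).continuousOn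
  have h3 := hφ.1.continuous
  simp only [div_eq_mul_inv]
  fun_prop

lemma IsRadialDeriv.sub {f g h k : E d → ℝ} (hf : IsRadialDeriv f h) (hg : IsRadialDeriv g k) :
    IsRadialDeriv (f - g) (h - k) := by
  refine ⟨hf.1.sub hg.1, hf.2.1.sub hg.2.1, fun φ hφ => ?_⟩
  have i1 := hf.2.1.integrable_test_smul hφ
  have i2 := hg.2.1.integrable_test_smul hφ
  have h0 : ∀ x ∉ tsupport φ, classicalRadial φ x + ((d : ℝ) - 1) / ‖x‖ * φ x = 0 := fun x hx => by
    rw [classicalRadial_eq_zero hx, IsTest.eq_zero hx]; simp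
  have i3 := hf.1.integrable_smul hφ (continuousOn_radial_test hφ) h0
  have i4 := hg.1.integrable_smul hφ (continuousOn_radial_test hφ) h0
  simp only [smul_eq_mul, mul_comm (φ _)] at i1 i2 i3 i4
  simp only [Pi.sub_apply, sub_mul]
  rw [integral_sub i1.integrableOn i2.integrableOn, integral_sub i3.integrableOn i4.integrableOn,
    hf.2.2 φ hφ, hg.2.2 φ hφ]
  ring

lemma IsSphericalGrad.sub {f g : E d → ℝ} {h k : E d → E d} (hf : IsSphericalGrad f h)
    (hg : IsSphericalGrad g k) : IsSphericalGrad (f - g) (h - k) := by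
  refine ⟨hf.1.sub hg.1, hf.2.1.sub hg.2.1, fun φ hφ => ?_⟩
  have i1 := hf.2.1.integrable_test_smul hφ
  have i2 := hg.2.1.integrable_test_smul hφ
  have h0 : ∀ x ∉ tsupport φ,
      classicalSpherical φ x - (((d : ℝ) - 1) * φ x / ‖x‖) • x = 0 := fun x hx => by
    rw [classicalSpherical_eq_zero hx, IsTest.eq_zero hx]; simp
  have i3 := hf.1.integrable_smul hφ (continuousOn_spherical_test hφ) h0
  have i4 := hg.1.integrable_smul hφ (continuousOn_spherical_test hφ) h0
  simp only [Pi.sub_apply, sub_smul]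
  simp only [smul_sub (φ _)]
  rw [integral_sub i1.integrableOn i2.integrableOn, integral_sub i3.integrableOn i4.integrableOn,
    hf.2.2 φ hφ, hg.2.2 φ hφ]
  abel

lemma isRadialDeriv_radialDeriv {f : E d → ℝ} (hf : ∃ h, IsRadialDeriv f h) :
    IsRadialDeriv f (radialDeriv f) := by
  rw [radialDeriv, dif_pos hf]; exact hf.choose_spec

lemma isSphericalGrad_sphericalGrad {f : E d → ℝ} (hf : ∃ h, IsSphericalGrad f h) :
    IsSphericalGrad f (sphericalGrad f) := by
  rw [sphericalGrad, dif_pos hf]; exact hf.choose_spec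

/-- `radialDeriv` is an arbitrary choice, and the form domain speaks of the derivative of u - f.
Linearity and uniqueness up to null sets turn that into a statement on the classical derivative of
u. -/
lemma radialDeriv_sub_ae_eq (hd : 2 ≤ d) {u f : E d → ℝ}
    (hu : ContDiffOn ℝ 1 u (puncturedBall d)) (hf : ∃ h, IsRadialDeriv f h) :
    radialDeriv (u - f) =ᵐ[volume.restrict (unitBall d)] classicalRadial u - radialDeriv f := by
  have h1 := (isRadialDeriv_classicalRadial hu).sub (isRadialDeriv_radialDeriv hf)
  have h2 := isRadialDeriv_radialDeriv ⟨_, h1⟩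
  refine ae_eq_of_forall_test hd h2.2.1 h1.2.1 fun φ hφ => ?_
  simp only [smul_eq_mul, mul_comm (φ _)]
  rw [h1.2.2 φ hφ, h2.2.2 φ hφ]

lemma sphericalGrad_sub_ae_eq (hd : 2 ≤ d) {u f : E d → ℝ}
    (hu : ContDiffOn ℝ 1 u (puncturedBall d)) (hf : ∃ h, IsSphericalGrad f h) :
    sphericalGrad (u - f) =ᵐ[volume.restrict (unitBall d)]
      classicalSpherical u - sphericalGrad f := by
  have h1 := (isSphericalGrad_classicalSpherical hu).sub (isSphericalGrad_sphericalGrad hf)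
  have h2 := isSphericalGrad_sphericalGrad ⟨_, h1⟩
  refine ae_eq_of_forall_test hd h2.2.1 h1.2.1 fun φ hφ => ?_
  rw [h1.2.2 φ hφ, h2.2.2 φ hφ]

/-- The spherical gradient satisfies |∇₀u|² = |x|²|∇u|² - (x·∇u)². Hence the two parts of Γ
recombine to |∇u|² - (x·∇u)², an expression without singularity at the origin. -/
lemma gradSq_eq (u : E d → ℝ) {x : E d} (hx : x ∈ puncturedBall d) :
    gradSq u x = (√(1 - ‖x‖ ^ 2) * classicalRadial u x) ^ 2 +
      (‖classicalSpherical u x‖ / ‖x‖) ^ 2 := by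
  have hn := norm_pos_of_mem hx
  have hg : ‖gradient u x‖ = ‖fderiv ℝ u x‖ := by simp [gradient]
  have hi : inner ℝ (gradient u x) x = fderiv ℝ u x x := by simp [gradient]
  have hs : ‖classicalSpherical u x‖ ^ 2 =
      ‖x‖ ^ 2 * ‖fderiv ℝ u x‖ ^ 2 - (fderiv ℝ u x x) ^ 2 := by
    rw [classicalSpherical, norm_sub_sq_real, norm_smul, norm_smul, inner_smul_left,
      inner_smul_right, hi, hg, mul_pow, mul_pow, Real.norm_eq_abs, Real.norm_eq_abs, sq_abs,
      sq_abs, classicalRadial]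
    simp only [conj_trivial]
    field_simp
    ring
  rw [mul_pow, Real.sq_sqrt (one_sub_sq_pos hx.1).le, div_pow, hs, gradSq, classicalRadial]
  field_simp
  ring

/-! ### From smooth functions to the form domain. -/

lemma ae_weight_mem_puncturedBall (hd : 2 ≤ d) (μ : ℝ) :
    ∀ᵐ x ∂(weight d μ), x ∈ puncturedBall d :=
  (withDensity_absolutelyContinuous _ _).ae_le (ae_mem_puncturedBall hd)

lemma lintegral_sq_eq_eLpNorm {α : Type*} [MeasurableSpace α] (ν : Measure α) (g : α → ℝ) :
    ∫⁻ x, ENNReal.ofReal (g x ^ 2) ∂ν = eLpNorm g 2 ν ^ 2 := by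
  have h := eLpNorm_nnreal_pow_eq_lintegral (f := g) (μ := ν) (p := 2) (by norm_num)
  have e : ((2 : NNReal) : ENNReal) = 2 := by simp
  rw [e] at h
  have e2 : (((2 : NNReal) : ℝ)) = ((2 : ℕ) : ℝ) := by simp
  rw [e2, ENNReal.rpow_natCast] at h
  rw [h]
  refine lintegral_congr fun x => ?_
  rw [ENNReal.rpow_natCast, ← sq_abs, ENNReal.ofReal_pow (abs_nonneg _), ← Real.norm_eq_abs,
    ofReal_norm]

/-- Cosine is decreasing only on [0, π], hence the truncation of r. For r > π the ball is
everything, and the cap with cosine -1 loses no interior point since the cosine of the distance from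
z to such a point exceeds -1. The boundary sphere is null. -/
lemma geoBall_ae_eq_cap (hd : 2 ≤ d) (μ : ℝ) {z : E d} (hz : z ∈ unitBall d) {r : ℝ} (hr : 0 < r) :
    geoBall z r =ᵐ[weight d μ] cap z (Real.cos (min r Real.pi)) := by
  filter_upwards [ae_weight_mem_puncturedBall hd μ] with x hx
  have hxb := Metric.ball_subset_closedBall hx.1
  have hz1 : ‖z‖ ≤ 1 := by simpa [unitBall] using hz
  have hx1 : ‖x‖ < 1 := by simpa using hx.1
  have habs := ballCos_le_one hz hxb
  have hgt : -1 < inner ℝ z x + height z * height x := by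
    have h1 := neg_le_of_abs_le (abs_real_inner_le_norm z x)
    have h2 := mul_nonneg (height_nonneg z) (height_nonneg x)
    nlinarith [norm_nonneg z, norm_nonneg x]
  have hmin : 0 ≤ min r Real.pi := le_min hr.le Real.pi_nonneg
  have key : ballDist z x < r ↔
      Real.cos (min r Real.pi) < inner ℝ z x + height z * height x := by
    change Real.arccos (inner ℝ z x + height z * height x) < r ↔ _
    set t := inner ℝ z x + height z * height x
    have hc : Real.cos (Real.arccos t) = t := Real.cos_arccos (abs_le.1 habs).1 (abs_le.1 habs).2
    constructor
    · intro h
      have hpi : Real.arccos t < Real.pi := by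
        refine lt_of_le_of_ne (Real.arccos_le_pi t) fun h => ?_
        rw [h, Real.cos_pi] at hc
        linarith
      conv_rhs => rw [← hc]
      exact Real.cos_lt_cos_of_nonneg_of_le_pi (Real.arccos_nonneg t) (min_le_right _ _)
        (lt_min h hpi)
    · intro h
      by_contra hcon
      rw [not_lt] at hcon
      have := Real.cos_le_cos_of_nonneg_of_le_pi hmin (Real.arccos_le_pi t)
        ((min_le_left r Real.pi).trans hcon)
      rw [hc] at this
      linarith
  apply propext
  exact ⟨fun h => ⟨hx.1, key.1 h.2⟩, fun h => ⟨hxb, key.2 h.2⟩⟩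

/-- The mean value minimizes the mean square deviation. -/
lemma integral_sq_sub_mean_le {α : Type*} [MeasurableSpace α] {P : Measure α} [IsFiniteMeasure P]
    {f : α → ℝ} (hf : MemLp f 2 P) (k : ℝ) :
    ∫ x, |f x - (P.real Set.univ)⁻¹ * ∫ y, f y ∂P| ^ 2 ∂P ≤ ∫ x, (f x - k) ^ 2 ∂P := by
  have hi : Integrable f P := hf.integrable (by norm_num)
  set m := (P.real Set.univ)⁻¹ * ∫ y, f y ∂P with hm
  rcases eq_or_ne P 0 with h0 | h0
  · rw [h0]; simp
  have hP : P.real Set.univ ≠ 0 := by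
    rw [Measure.real, ENNReal.toReal_ne_zero]
    exact ⟨by simpa using h0, measure_ne_top _ _⟩
  have hfm : MemLp (fun x => f x - m) 2 P := hf.sub (memLp_const m)
  have h2 : ∫ x, (f x - k) ^ 2 ∂P =
      ∫ x, |f x - m| ^ 2 ∂P + (m - k) ^ 2 * P.real Set.univ := by
    have e : ∀ x, (f x - k) ^ 2 = |f x - m| ^ 2 + (2 * (m - k) * (f x - m) + (m - k) ^ 2) :=
      fun x => by rw [sq_abs]; ring
    simp only [e]
    have i1 : Integrable (fun x => |f x - m| ^ 2) P := by
      simpa only [sq_abs] using hfm.integrable_sq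
    have i2 : Integrable (fun x => 2 * (m - k) * (f x - m)) P :=
      (hi.sub (integrable_const m)).const_mul _
    have i3 : Integrable (fun x => 2 * (m - k) * (f x - m) + (m - k) ^ 2) P :=
      i2.add (integrable_const _)
    rw [integral_add i1 i3, integral_add i2 (integrable_const _),
      integral_const_mul, integral_sub hi (integrable_const m), integral_const, integral_const]
    simp only [smul_eq_mul]
    have : ∫ y, f y ∂P = P.real Set.univ * m := by rw [hm]; field_simp
    rw [this]
    ring
  rw [h2]
  have : 0 ≤ (m - k) ^ 2 * P.real Set.univ := by positivity
  linarith

lemma measurable_classicalRadial (u : E d → ℝ) : Measurable (classicalRadial u) := by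
  have : Continuous fun p : (E d →L[ℝ] ℝ) × E d => p.1 p.2 := by fun_prop
  exact (this.measurable.comp ((measurable_fderiv ℝ u).prodMk measurable_id)).div
    measurable_norm

lemma energyDensity_self (f : E d → ℝ) {x : E d} (hx : x ∈ Metric.ball (0 : E d) 1) :
    energyDensity f f x = (√(1 - ‖x‖ ^ 2) * radialDeriv f x) ^ 2 +
      (‖sphericalGrad f x‖ / ‖x‖) ^ 2 := by
  rw [energyDensity, mul_pow, Real.sq_sqrt (one_sub_sq_pos hx).le, real_inner_self_eq_norm_sq,
    div_pow]
  ring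

lemma FormDomain.integrable_energyDensity (hd : 2 ≤ d) {μ : ℝ} {f : E d → ℝ}
    (hf : FormDomain d μ f) : Integrable (energyDensity f f) (weight d μ) := by
  refine (hf.memLp_radial.integrable_sq.add hf.memLp_spherical.integrable_sq).congr ?_
  filter_upwards [ae_weight_mem_puncturedBall hd μ] with x hx
  exact (energyDensity_self f hx.1).symm

lemma energyDensity_self_nonneg (hd : 2 ≤ d) (μ : ℝ) (f : E d → ℝ) :
    0 ≤ᵐ[weight d μ] energyDensity f f := by
  filter_upwards [ae_weight_mem_puncturedBall hd μ] with x hx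
  rw [energyDensity_self f hx.1]
  exact add_nonneg (sq_nonneg _) (sq_nonneg _)

/-- The energy of a smooth function is bounded by the energies of `f` and of the difference. -/
lemma setLIntegral_gradSq_le (hd : 2 ≤ d) {μ : ℝ} {f : E d → ℝ} (hf : FormDomain d μ f)
    {u : E d → ℝ} (hu : ContDiffOn ℝ 1 u (Metric.ball 0 1)) (S : Set (E d)) :
    ∫⁻ x in S, ENNReal.ofReal (gradSq u x) ∂(weight d μ) ≤
      2 * ∫⁻ x in S, ENNReal.ofReal (energyDensity f f x) ∂(weight d μ) +
        2 * (eLpNorm (fun x => √(1 - ‖x‖ ^ 2) * radialDeriv (u - f) x) 2 (weight d μ) ^ 2 +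
          eLpNorm (fun x => ‖sphericalGrad (u - f) x‖ / ‖x‖) 2 (weight d μ) ^ 2) := by
  have hu' : ContDiffOn ℝ 1 u (puncturedBall d) := hu.mono Set.sdiff_subset
  have hac : weight d μ ≪ volume.restrict (unitBall d) := withDensity_absolutelyContinuous _ _
  have hR := hac.ae_le (radialDeriv_sub_ae_eq hd hu' hf.exists_radial)
  have hS := hac.ae_le (sphericalGrad_sub_ae_eq hd hu' hf.exists_spherical)
  set δ : E d → ℝ := fun x => √(1 - ‖x‖ ^ 2) * radialDeriv (u - f) x with hδ
  set η : E d → ℝ := fun x => ‖sphericalGrad (u - f) x‖ / ‖x‖ with hη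
  have hδm : AEMeasurable δ (weight d μ) := by
    have h1 : Measurable fun x : E d => √(1 - ‖x‖ ^ 2) * classicalRadial u x := by
      have := measurable_classicalRadial u
      fun_prop
    refine (h1.aemeasurable.sub hf.memLp_radial.1.aemeasurable).congr ?_
    filter_upwards [hR] with x hx
    simp only [hδ, hx, Pi.sub_apply]
    ring
  have hem := (hf.integrable_energyDensity hd).1.aemeasurable
  rw [← lintegral_sq_eq_eLpNorm, ← lintegral_sq_eq_eLpNorm, ← lintegral_add_left' (by fun_prop)]
  calc ∫⁻ x in S, ENNReal.ofReal (gradSq u x) ∂(weight d μ)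
      ≤ ∫⁻ x in S, (2 * ENNReal.ofReal (energyDensity f f x) +
          2 * (ENNReal.ofReal (δ x ^ 2) + ENNReal.ofReal (η x ^ 2))) ∂(weight d μ) := by
        refine lintegral_mono_ae (ae_restrict_of_ae ?_)
        filter_upwards [hR, hS, ae_weight_mem_puncturedBall hd μ] with x hx1 hx2 hx
        have hn := norm_pos_of_mem hx
        have h1 : √(1 - ‖x‖ ^ 2) * classicalRadial u x =
            √(1 - ‖x‖ ^ 2) * radialDeriv f x + δ x := by
          simp only [hδ, hx1, Pi.sub_apply]; ring
        have h2 : ‖classicalSpherical u x‖ / ‖x‖ ≤ ‖sphericalGrad f x‖ / ‖x‖ + η x := by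
          rw [hη, ← add_div]
          gcongr
          rw [hx2]
          simpa using norm_add_le (sphericalGrad f x) (classicalSpherical u x - sphericalGrad f x)
        rw [← ENNReal.ofReal_add (sq_nonneg _) (sq_nonneg _), ← ENNReal.ofReal_ofNat,
          ← ENNReal.ofReal_mul (by norm_num), ← ENNReal.ofReal_mul (by norm_num),
          ← ENNReal.ofReal_add (by rw [energyDensity_self f hx.1]; positivity) (by positivity)]
        refine ENNReal.ofReal_le_ofReal ?_
        rw [gradSq_eq u hx, energyDensity_self f hx.1, h1]
        have h3 : (‖classicalSpherical u x‖ / ‖x‖) ^ 2 ≤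
            (‖sphericalGrad f x‖ / ‖x‖ + η x) ^ 2 := by gcongr
        nlinarith [sq_nonneg (√(1 - ‖x‖ ^ 2) * radialDeriv f x - δ x),
          sq_nonneg (‖sphericalGrad f x‖ / ‖x‖ - η x)]
    _ = 2 * ∫⁻ x in S, ENNReal.ofReal (energyDensity f f x) ∂(weight d μ) +
          2 * ∫⁻ x in S, (ENNReal.ofReal (δ x ^ 2) + ENNReal.ofReal (η x ^ 2)) ∂(weight d μ) := by
        have hem' : AEMeasurable (fun x => ENNReal.ofReal (energyDensity f f x))
          ((weight d μ).restrict S) := hem.ennreal_ofReal.restrict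
        rw [lintegral_add_left' (hem'.const_mul _), lintegral_const_mul'' _ hem',
          lintegral_const_mul' _ _ (by norm_num)]
    _ ≤ _ := by
        gcongr
        exact Measure.restrict_le_self

/-- The Poincaré inequality for a function in the form domain, up to the error of approximation by
a smooth function. -/
lemma exists_setLIntegral_sq_sub_le (hd : 2 ≤ d) {μ : ℝ} {f : E d → ℝ} (hf : FormDomain d μ f)
    {u : E d → ℝ} (hu : ContDiffOn ℝ 2 u (unitBall d)) {S : Set (E d)} {c : ENNReal}
    (hP : ∀ v : E d → ℝ, ContDiffOn ℝ 1 v (Metric.ball 0 1) → Measurable v →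
      ∃ k : ℝ, ∫⁻ x in S, ENNReal.ofReal ((v x - k) ^ 2) ∂(weight d μ) ≤
        c * ∫⁻ x in S, ENNReal.ofReal (gradSq v x) ∂(weight d μ)) :
    ∃ k : ℝ, ∫⁻ x in S, ENNReal.ofReal ((f x - k) ^ 2) ∂(weight d μ) ≤
      2 * eLpNorm (u - f) 2 (weight d μ) ^ 2 + 2 * (c *
        (2 * ∫⁻ x in S, ENNReal.ofReal (energyDensity f f x) ∂(weight d μ) +
        2 * (eLpNorm (fun x => √(1 - ‖x‖ ^ 2) * radialDeriv (u - f) x) 2 (weight d μ) ^ 2 +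
          eLpNorm (fun x => ‖sphericalGrad (u - f) x‖ / ‖x‖) 2 (weight d μ) ^ 2))) := by
  have hu1 : ContDiffOn ℝ 1 u (Metric.ball 0 1) :=
    (hu.mono Metric.ball_subset_closedBall).of_le (by norm_num)
  -- Outside the closed ball u is arbitrary and may fail to be measurable; truncation to the open
  -- ball repairs this without changing u or its derivative almost everywhere.
  set v : E d → ℝ := (Metric.ball 0 1).indicator u with hv
  have hvu : Set.EqOn v u (Metric.ball 0 1) := fun x hx => Set.indicator_of_mem hx u
  have hvm : Measurable v := by
    classical
    rw [hv, ← Set.piecewise_eq_indicator]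
    exact hu1.continuousOn.measurable_piecewise continuousOn_const measurableSet_ball
  have hv1 : ContDiffOn ℝ 1 v (Metric.ball 0 1) := hu1.congr hvu
  obtain ⟨k, hk⟩ := hP v hv1 hvm
  refine ⟨k, ?_⟩
  have hball : ∀ᵐ x ∂((weight d μ).restrict S), x ∈ Metric.ball (0 : E d) 1 :=
    ae_restrict_of_ae ((ae_weight_mem_puncturedBall hd μ).mono fun x hx => hx.1)
  have hgrad : ∫⁻ x in S, ENNReal.ofReal (gradSq v x) ∂(weight d μ) =
      ∫⁻ x in S, ENNReal.ofReal (gradSq u x) ∂(weight d μ) := by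
    refine lintegral_congr_ae ?_
    filter_upwards [hball] with x hx
    have : v =ᶠ[𝓝 x] u := hvu.eventuallyEq_of_mem (Metric.isOpen_ball.mem_nhds hx)
    rw [gradSq, gradSq, this.fderiv_eq]
  rw [hgrad] at hk
  calc ∫⁻ x in S, ENNReal.ofReal ((f x - k) ^ 2) ∂(weight d μ)
      ≤ ∫⁻ x in S, (2 * ENNReal.ofReal ((u x - f x) ^ 2) +
          2 * ENNReal.ofReal ((v x - k) ^ 2)) ∂(weight d μ) := by
        refine lintegral_mono_ae ?_
        filter_upwards [hball] with x hx
        rw [sub_sq_comm (u x), ← hvu hx]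
        exact ofReal_sub_sq_le _ _ _
    _ = 2 * ∫⁻ x in S, ENNReal.ofReal ((u x - f x) ^ 2) ∂(weight d μ) +
          2 * ∫⁻ x in S, ENNReal.ofReal ((v x - k) ^ 2) ∂(weight d μ) := by
        rw [lintegral_add_right _ (by fun_prop), lintegral_const_mul' _ _ (by norm_num),
          lintegral_const_mul' _ _ (by norm_num)]
    _ ≤ _ := by
        gcongr
        · rw [← lintegral_sq_eq_eLpNorm]
          exact setLIntegral_le_lintegral _ _
        · exact hk.trans (by gcongr; exact setLIntegral_gradSq_le hd hf hu1 S)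

/-- The scale-invariant Poincaré inequality for the closed form on geodesic balls. -/
theorem poincare_inequality (d : ℕ) (hd : 2 ≤ d) (μ : ℝ) (hμ : -1 / 2 < μ) :
    ∃ C : ℝ, 0 < C ∧ ∀ f : E d → ℝ, FormDomain d μ f →
      ∀ z ∈ unitBall d, ∀ r : ℝ, 0 < r →
        ∫ x in geoBall z r, |f x - mean μ f (geoBall z r)| ^ 2 ∂(weight d μ) ≤
          C * (r ^ 2 * ∫ x in geoBall z r, energyDensity f f x ∂(weight d μ)) := by
  obtain ⟨C, hC, hP⟩ := exists_poincare_cap hd hμ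
  -- One factor 2 comes from splitting f - k into (f - u) + (u - k), the other from comparing the
  -- energy of u with that of f.
  refine ⟨4 * C, by positivity, fun f hf z hz r hr => ?_⟩
  have : IsFiniteMeasure (weight d μ) := ⟨weight_univ_lt_top hd hμ⟩
  set S := geoBall z r with hS
  have hres := Measure.restrict_congr_set (geoBall_ae_eq_cap hd μ hz hr)
  have hPS : ∀ v : E d → ℝ, ContDiffOn ℝ 1 v (Metric.ball 0 1) → Measurable v →
      ∃ k : ℝ, ∫⁻ x in S, ENNReal.ofReal ((v x - k) ^ 2) ∂(weight d μ) ≤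
        ENNReal.ofReal (C * r ^ 2) * ∫⁻ x in S, ENNReal.ofReal (gradSq v x) ∂(weight d μ) := by
    rw [hS, hres]
    exact fun v hv hvm => hP v hv hvm z hz r hr
  set I : ENNReal := ∫⁻ x in S, ENNReal.ofReal (energyDensity f f x) ∂(weight d μ) with hI
  have hIe : ENNReal.ofReal (∫ x in S, energyDensity f f x ∂(weight d μ)) = I :=
    ofReal_integral_eq_lintegral_ofReal (hf.integrable_energyDensity hd).integrableOn
      (ae_restrict_of_ae (energyDensity_self_nonneg hd μ f))
  have hI0 : 0 ≤ ∫ x in S, energyDensity f f x ∂(weight d μ) :=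
    integral_nonneg_of_ae (ae_restrict_of_ae (energyDensity_self_nonneg hd μ f))
  have hfS : MemLp f 2 ((weight d μ).restrict S) := hf.memLp.restrict S
  have hmean : mean μ f S =
      (((weight d μ).restrict S).real Set.univ)⁻¹ * ∫ y in S, f y ∂(weight d μ) := by
    rw [mean, measureReal_restrict_apply_univ]
  obtain ⟨u, hu, hu0, huR, huS⟩ := hf.approx
  have hn : ∀ n, ENNReal.ofReal (∫ x in S, |f x - mean μ f S| ^ 2 ∂(weight d μ)) ≤
      2 * eLpNorm (u n - f) 2 (weight d μ) ^ 2 + 2 * (ENNReal.ofReal (C * r ^ 2) * (2 * I +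
        2 * (eLpNorm (fun x => √(1 - ‖x‖ ^ 2) * radialDeriv (u n - f) x) 2 (weight d μ) ^ 2 +
          eLpNorm (fun x => ‖sphericalGrad (u n - f) x‖ / ‖x‖) 2 (weight d μ) ^ 2))) := by
    intro n
    obtain ⟨k, hk⟩ := exists_setLIntegral_sq_sub_le hd hf (hu n) hPS
    refine le_trans ?_ hk
    have hi : Integrable (fun x => (f x - k) ^ 2) ((weight d μ).restrict S) :=
      (hfS.sub (memLp_const k)).integrable_sq
    rw [← ofReal_integral_eq_lintegral_ofReal hi (Eventually.of_forall fun _ => sq_nonneg _), hmean]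
    -- The constant k depends on n and need not converge; replacing it by the mean of f makes the
    -- left side independent of n before the limit.
    exact ENNReal.ofReal_le_ofReal (integral_sq_sub_mean_le hfS k)
  have h2 : (2 : ENNReal) ≠ ⊤ := by norm_num
  have hsq : ∀ {a : ℕ → ENNReal}, Tendsto a atTop (𝓝 0) →
      Tendsto (fun n => a n ^ 2) atTop (𝓝 (0 ^ 2)) := fun h => ENNReal.Tendsto.pow h
  have hlim := (ENNReal.Tendsto.const_mul (hsq hu0) (Or.inr h2)).add
    (ENNReal.Tendsto.const_mul (ENNReal.Tendsto.const_mul ((tendsto_const_nhds (x := 2 * I)).add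
      (ENNReal.Tendsto.const_mul ((hsq huR).add (hsq huS)) (Or.inr h2)))
      (Or.inr (ENNReal.ofReal_ne_top (r := C * r ^ 2)))) (Or.inr h2))
  have hfin := ge_of_tendsto' hlim hn
  have e : 2 * (0 : ENNReal) ^ 2 + 2 * (ENNReal.ofReal (C * r ^ 2) * (2 * I +
      2 * ((0 : ENNReal) ^ 2 + 0 ^ 2))) =
      ENNReal.ofReal (4 * C * (r ^ 2 * ∫ x in S, energyDensity f f x ∂(weight d μ))) := by
    rw [show 4 * C * (r ^ 2 * ∫ x in S, energyDensity f f x ∂(weight d μ)) =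
      4 * ((C * r ^ 2) * ∫ x in S, energyDensity f f x ∂(weight d μ)) by ring,
      ENNReal.ofReal_mul (p := 4) (by norm_num),
      ENNReal.ofReal_mul (p := C * r ^ 2) (by positivity), hIe]
    simp only [ENNReal.ofReal_ofNat]
    ring
  rw [e] at hfin
  exact (ENNReal.ofReal_le_ofReal_iff (by positivity)).1 hfin

end BallDirichlet

theorem theorem2 (d : ℕ) (hd : 2 ≤ d) (μ : ℝ) (hμ : -1 / 2 < μ) :
    ∃ C : ℝ, 0 < C ∧ ∀ f : BallDirichlet.E d → ℝ, BallDirichlet.FormDomain d μ f →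
      ∀ z ∈ BallDirichlet.unitBall d, ∀ r : ℝ, 0 < r →
        ∫ x in BallDirichlet.geoBall z r,
            |f x - BallDirichlet.mean μ f (BallDirichlet.geoBall z r)| ^ 2
              ∂(BallDirichlet.weight d μ) ≤
          C * (r ^ 2 * ∫ x in BallDirichlet.geoBall z r,
            BallDirichlet.energyDensity f f x ∂(BallDirichlet.weight d μ)) :=
  BallDirichlet.poincare_inequality d hd μ hμ
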